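/- Theorem 4.2 ($\Gamma$-convergence of the discrete energy). Let $p>1$ and let $\Omega\subseteq\mathbb R$ be either $\mathbb R$ or a compact interval $[a,b]$ with $a<b$. Let $\mathcal P_p(\Omega)$ be the set of Borel probability measures on $\Omega$ with finite $p$-th moment, and let $W_p$ be the $p$-Wasserstein distance, $W_p(\mu,\nu)=\inf_\pi\big(\int|x-y|^p\,d\pi(x,y)\big)^{1/p}$ over all couplings $\pi$ of $\mu,\nu$. Let $H:[0,\infty)\to[0,\infty)$ be convex, continuous on $[0,\infty)$ and $C^\infty$ on $(0,\infty)$, with $H(0)=0$ and $H(x)/x\to\infty$ as $x\to\infty$. Assume that there is a constant $A>0$ with $H(x+y)\le A(1+H(x)+H(y))$ for all $x,y\ge0$, and that $x\mapsto xH(x^{-1})$ is strictly convex and non-increasing on $(0,\infty)$. Assume moreover that there are continuous functions $f_1,f_2:[0,\infty)\to\mathbb R$ with $f_1(1)=1$, $f_2(1)=0$ and $$H(\alpha x)\le f_1(\alpha)H(x)+f_2(\alpha)x\qquad\text{for all }x,\alpha\in[0,\infty).$$ For $\mu\in\mathcal P_p(\Omega)$ put $E(\mu)=\int_\Omega H(\rho(x))\,dx$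 if $\mu=\rho\,dx$ is absolutely continuous with respect to Lebesgue measure, and $E(\mu)=+\infty$ otherwise. For $N\ge2$ let $\mathcal A_N(\Omega)$ be the set of measures $\mu=\frac1N\sum_{i=1}^N\delta_{x_i}$ with $x_1<\dots<x_N$ in $\Omega$, and for such $\mu$ put $$E_N(\mu)=\sum_{i=1}^N|B_i|\,H\!\left(\frac1{N|B_i|}\right),$$ where $B_i$ is the open ball (interval) in $\mathbb R$ with centre $x_i$ and radius $\frac12\min_{j\ne i}|x_i-x_j|$, and $|B_i|$ is its length. Then $(E_N)_{N\ge2}$ $\Gamma$-converges to $E$ with respect to $W_p$, i.e. for every $\rho\in\mathcal P_p(\Omega)$: (i) for every sequence $(\mu_N)_{N\ge2}$ with $\mu_N\in\mathcal A_N(\Omega)$ and $W_p(\mu_N,\rho)\to0$, one has $E(\rho)\le\liminf_{N\to\infty}E_N(\mu_N)$; (ii) there is a sequence $(\mu_N)_{N\ge2}$ with $\mu_N\in\mathcal A_N(\Omega)$, $W_p(\mu_N,\rho)\to0$ and $\limsup_{N\to\infty}E_N(\mu_N)\le E(\rho)$. -/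

import Mathlib

open Set Filter Topology MeasureTheory
open scoped ENNReal

noncomputable section

namespace ParticleGamma

/-- The admissible one-dimensional domains: the whole line, or the closure `[a, b]` of a
(nonempty) bounded open interval. -/
def IsAdmissibleDomain (Ω : Set ℝ) : Prop :=
  Ω = univ ∨ ∃ a b : ℝ, a < b ∧ Ω = Icc a b

/-- The standing hypothesis on the internal energy density `H : [0, ∞) → ℝ` in dimension one.
Only the values of `H` on `[0, ∞)` matter; properness is automatic as `H` is real-valued. -/
structure IsEnergyDensity (H : ℝ → ℝ) : Prop where
  convex : ConvexOn ℝ (Ici 0) H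
  nonneg : ∀ x, 0 ≤ x → 0 ≤ H x
  smooth : ContDiffOn ℝ (⊤ : ℕ∞) H (Ioi 0)
  continuous : ContinuousOn H (Ici 0)
  superlinear : Tendsto (fun x => H x / x) atTop atTop
  map_zero : H 0 = 0
  doubling : ∃ A : ℝ, 0 < A ∧ ∀ x y, 0 ≤ x → 0 ≤ y → H (x + y) ≤ A * (1 + H x + H y)
  strictConvex_h : StrictConvexOn ℝ (Ioi 0) (fun x => x * H x⁻¹)
  antitone_h : AntitoneOn (fun x => x * H x⁻¹) (Ioi 0)

/-- The scaling condition `H (α x) ≤ f₁(α) H(x) + f₂(α) x` for all `x, α ≥ 0`. -/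
def ScalingCondition (H : ℝ → ℝ) : Prop :=
  ∃ f₁ f₂ : ℝ → ℝ, ContinuousOn f₁ (Ici 0) ∧ ContinuousOn f₂ (Ici 0) ∧ f₁ 1 = 1 ∧ f₂ 1 = 0 ∧
    ∀ x α : ℝ, 0 ≤ x → 0 ≤ α → H (α * x) ≤ f₁ α * H x + f₂ α * x

/-- `𝒫_p(Ω)`: Borel probability measures on `ℝ` that are concentrated on `Ω` and have finite
`p`-th moment. -/
def ProbP (p : ℝ) (Ω : Set ℝ) : Set (Measure ℝ) :=
  {μ | IsProbabilityMeasure μ ∧ μ Ωᶜ = 0 ∧ ∫⁻ x, ‖x‖ₑ ^ p ∂μ < ∞}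

/-- The set of couplings (transport plans) of `μ` and `ν`. -/
def Couplings (μ ν : Measure ℝ) : Set (Measure (ℝ × ℝ)) :=
  {π | IsProbabilityMeasure π ∧ π.map Prod.fst = μ ∧ π.map Prod.snd = ν}

/-- The `p`-Wasserstein distance (with values in `[0, ∞]`). -/
def wassersteinDist (p : ℝ) (μ ν : Measure ℝ) : ℝ≥0∞ :=
  ⨅ π ∈ Couplings μ ν, (∫⁻ z, edist z.1 z.2 ^ p ∂π) ^ (1 / p)

open scoped Classical in
/-- The continuum energy `E(μ) = ∫_Ω H(ρ(x)) dx` if `μ = ρ dx`, and `+∞` otherwise. It takes values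
in `[0, ∞]`, as it is only used for `H ≥ 0` on `[0, ∞)`. -/
def energy (H : ℝ → ℝ) (Ω : Set ℝ) (μ : Measure ℝ) : ℝ≥0∞ :=
  if μ ≪ volume then ∫⁻ x in Ω, ENNReal.ofReal (H (μ.rnDeriv volume x).toReal) else ∞

/-- The empirical measure `(1/N) ∑ᵢ δ_{xᵢ}`. -/
def empirical {N : ℕ} (x : Fin N → ℝ) : Measure ℝ :=
  (N : ℝ≥0∞)⁻¹ • ∑ i, Measure.dirac (x i)

/-- `𝒜_N(Ω)`: empirical measures of `N` particles of `Ω`, which are assumed to be distinct and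
sorted increasingly. -/
def Atomic (N : ℕ) (Ω : Set ℝ) : Set (Measure ℝ) :=
  {μ | ∃ x : Fin N → ℝ, StrictMono x ∧ (∀ i, x i ∈ Ω) ∧ μ = empirical x}

/-- The ball `Bᵢ` with centre `xᵢ` and radius `½ min_{j ≠ i} |xᵢ - xⱼ|`. -/
def particleBall {N : ℕ} (x : Fin N → ℝ) (i : Fin N) : Set ℝ :=
  Metric.ball (x i) ((⨅ j : {j : Fin N // j ≠ i}, |x i - x j|) / 2)

/-- The discrete energy as a function of the particles: `∑ᵢ |Bᵢ| H(1 / (N |Bᵢ|))`. -/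
def particleEnergy (H : ℝ → ℝ) {N : ℕ} (x : Fin N → ℝ) : ℝ :=
  ∑ i, volume.real (particleBall x i) * H (1 / (N * volume.real (particleBall x i)))

/-- The discrete energy `E_N(μ)` as a function of the measure `μ ∈ 𝒜_N`. The infimum is over
the sorted particles of `μ`, which are unique (see `discreteEnergy_empirical`). -/
def discreteEnergy (H : ℝ → ℝ) (N : ℕ) (μ : Measure ℝ) : ℝ≥0∞ :=
  ⨅ x ∈ {x : Fin N → ℝ | StrictMono x ∧ μ = empirical x}, ENNReal.ofReal (particleEnergy H x)

theorem empirical_singleton_ne_zero {N : ℕ} (x : Fin N → ℝ) (a : ℝ) :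
    empirical x {a} ≠ 0 ↔ a ∈ range x := by
  have hN : (N : ℝ≥0∞)⁻¹ ≠ 0 := by simp
  simp [empirical, Set.indicator_apply, hN]

theorem empirical_injOn {N : ℕ} {x y : Fin N → ℝ} (hx : StrictMono x) (hy : StrictMono y)
    (h : empirical x = empirical y) : x = y := by
  refine (hx.range_inj hy).1 ?_
  ext a
  rw [← empirical_singleton_ne_zero, ← empirical_singleton_ne_zero, h]

/-- The discrete energy of an empirical measure is the energy of its sorted particles. -/
theorem discreteEnergy_empirical (H : ℝ → ℝ) {N : ℕ} {x : Fin N → ℝ} (hx : StrictMono x) :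
    discreteEnergy H N (empirical x) = ENNReal.ofReal (particleEnergy H x) := by
  refine le_antisymm (iInf₂_le x ⟨hx, rfl⟩) (le_iInf₂ fun y hy => ?_)
  rw [empirical_injOn hx hy.1 hy.2]

/-- `Γ`-convergence, with respect to the `p`-Wasserstein distance, of functionals `F N` on
`𝒜_N(Ω)`, `N ≥ 2`, to a functional `F'` on `𝒫_p(Ω)`. The values of a sequence at `N < 2` play
no role. -/
def GammaConverges (p : ℝ) (Ω : Set ℝ) (F : ℕ → Measure ℝ → ℝ≥0∞) (F' : Measure ℝ → ℝ≥0∞) :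
    Prop :=
  ∀ ρ ∈ ProbP p Ω,
    (∀ μ : ℕ → Measure ℝ, (∀ N, 2 ≤ N → μ N ∈ Atomic N Ω) →
      Tendsto (fun N => wassersteinDist p (μ N) ρ) atTop (𝓝 0) →
      F' ρ ≤ liminf (fun N => F N (μ N)) atTop) ∧
    (∃ μ : ℕ → Measure ℝ, (∀ N, 2 ≤ N → μ N ∈ Atomic N Ω) ∧
      Tendsto (fun N => wassersteinDist p (μ N) ρ) atTop (𝓝 0) ∧
      limsup (fun N => F N (μ N)) atTop ≤ F' ρ)

end ParticleGamma

end

/-!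
The discrete and the continuum energy are compared through the supremum, over finite families of
disjoint intervals `I`, of the cell energies `∑ |I| H(ρ(I) / |I|)`. Jensen's inequality for the
disjoint gaps of the particles in `I` shows that the discrete energy dominates the cell energies of
`μ_N`, up to one particle per interval, and the masses of open sets are lower semicontinuous under
Wasserstein convergence. Conversely, a finite supremum forces absolute continuity, since `H` is
superlinear, and Lebesgue differentiation along finer and finer grids together with Fatou's lemma
recovers `∫ H(ρ)`. For the recovery sequence, a large interval is cut into small cells, and each
cell receives equally spaced particles in proportion to its mass; the energy of such a
configuration is the cell energy of the grid, which Jensen's inequality bounds by `∫ H(ρ)`.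
-/

namespace ParticleGamma

/-! ### Convex energy densities -/

/-- A convex nonnegative density on `[0, ∞)` vanishing at the origin: the part of
`IsEnergyDensity` that gives every inequality between the discrete and the continuum energy.
Values at negative arguments are irrelevant. -/
structure IsConvexDensity (H : ℝ → ℝ) : Prop where
  convexOn : ConvexOn ℝ (Ici 0) H
  nonneg : ∀ x, 0 ≤ x → 0 ≤ H x
  map_zero : H 0 = 0

theorem IsEnergyDensity.isConvexDensity {H : ℝ → ℝ} (hH : IsEnergyDensity H) :
    IsConvexDensity H :=
  ⟨hH.convex, hH.nonneg, hH.map_zero⟩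

namespace IsConvexDensity

variable {H : ℝ → ℝ}

theorem map_sum_mul_le (hH : IsConvexDensity H) {ι : Type*} {s : Finset ι} {w q : ι → ℝ}
    (hw : ∀ i ∈ s, 0 ≤ w i) (hw1 : ∑ i ∈ s, w i ≤ 1) (hq : ∀ i ∈ s, 0 ≤ q i) :
    H (∑ i ∈ s, w i * q i) ≤ ∑ i ∈ s, w i * H (q i) := by
  have := hH.convexOn.map_add_sum_le (v := 1 - ∑ i ∈ s, w i) (q := 0) hw (by ring)
    (fun i hi => mem_Ici.2 (hq i hi)) (by linarith) (mem_Ici.2 le_rfl)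
  simpa [hH.map_zero] using this

theorem map_mul_le (hH : IsConvexDensity H) {t x : ℝ} (ht0 : 0 ≤ t) (ht1 : t ≤ 1)
    (hx : 0 ≤ x) : H (t * x) ≤ t * H x := by
  simpa using hH.map_sum_mul_le (s := {()}) (w := fun _ => t) (q := fun _ => x)
    (by simpa) (by simpa) (by simpa)

theorem monotoneOn (hH : IsConvexDensity H) : MonotoneOn H (Ici 0) := by
  intro x hx y hy hxy
  have hxy1 : x / y ≤ 1 := div_le_one_of_le₀ hxy hy
  calc H x = H (x / y * y) := by rw [div_mul_cancel_of_imp fun h => le_antisymm (h ▸ hxy) hx]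
    _ ≤ x / y * H y := hH.map_mul_le (div_nonneg hx hy) hxy1 hy
    _ ≤ H y := mul_le_of_le_one_left (hH.nonneg y hy) hxy1

theorem continuousOn (hH : IsConvexDensity H) : ContinuousOn H (Ici 0) := by
  intro a ha
  rcases (mem_Ici.1 ha).eq_or_lt with rfl | ha
  · have h_lin : ∀ᶠ x in 𝓝[≥] (0 : ℝ), H x ≤ x * H 1 := by
      filter_upwards [Icc_mem_nhdsGE zero_lt_one] with x hx
      simpa using hH.map_mul_le hx.1 hx.2 zero_le_one
    have h_zero : Tendsto (fun x => x * H 1) (𝓝[≥] (0 : ℝ)) (𝓝 0) := by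
      have : Continuous fun x => x * H 1 := by fun_prop
      simpa using (this.tendsto 0).mono_left nhdsWithin_le_nhds
    rw [ContinuousWithinAt, hH.map_zero]
    exact squeeze_zero' (eventually_mem_nhdsWithin.mono hH.nonneg) h_lin h_zero
  · have h := (hH.convexOn.subset Ioi_subset_Ici_self (convex_Ioi 0)).continuousOn isOpen_Ioi
    exact (h.continuousAt (Ioi_mem_nhds ha)).continuousWithinAt

theorem tendsto_comp (hH : IsConvexDensity H) {ι : Type*} {l : Filter ι} {u : ι → ℝ} {a : ℝ}
    (hu : ∀ i, 0 ≤ u i) (ha : 0 ≤ a) (h : Tendsto u l (𝓝 a)) :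
    Tendsto (fun i => H (u i)) l (𝓝 (H a)) :=
  (hH.continuousOn a ha).tendsto.comp (tendsto_nhdsWithin_iff.2 ⟨h, .of_forall hu⟩)

theorem mul_map_sum_div_le (hH : IsConvexDensity H) {ι : Type*} {s : Finset ι} {g w : ι → ℝ}
    {V : ℝ} (hg : ∀ i ∈ s, 0 < g i) (hw : ∀ i ∈ s, 0 ≤ w i) (hV : 0 < V)
    (hgV : ∑ i ∈ s, g i ≤ V) :
    V * H ((∑ i ∈ s, w i) / V) ≤ ∑ i ∈ s, g i * H (w i / g i) := by
  have h_jensen : H (∑ i ∈ s, g i / V * (w i / g i)) ≤ ∑ i ∈ s, g i / V * H (w i / g i) :=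
    hH.map_sum_mul_le (fun i hi => (div_pos (hg i hi) hV).le)
      (by rwa [← Finset.sum_div, div_le_one hV]) (fun i hi => div_nonneg (hw i hi) (hg i hi).le)
  have h_sum : (∑ i ∈ s, w i) / V = ∑ i ∈ s, g i / V * (w i / g i) := by
    rw [Finset.sum_div]
    refine Finset.sum_congr rfl fun i hi => ?_
    have := (hg i hi).ne'
    field_simp
  calc V * H ((∑ i ∈ s, w i) / V)
      ≤ V * ∑ i ∈ s, g i / V * H (w i / g i) := by
        rw [h_sum]
        exact mul_le_mul_of_nonneg_left h_jensen hV.le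
    _ = ∑ i ∈ s, g i * H (w i / g i) := by
        rw [Finset.mul_sum]
        refine Finset.sum_congr rfl fun i _ => ?_
        field_simp

theorem mul_map_div_antitone (hH : IsConvexDensity H) {g g' w : ℝ} (hg : 0 < g) (hgg' : g ≤ g')
    (hw : 0 ≤ w) : g' * H (w / g') ≤ g * H (w / g) := by
  simpa using hH.mul_map_sum_div_le (s := {()}) (g := fun _ => g) (w := fun _ => w)
    (by simpa) (by simpa) (hg.trans_le hgg') (by simpa)

theorem map_add_le (hH : IsConvexDensity H) {s t : ℝ} (hs : 0 ≤ s) (ht0 : 0 ≤ t) (ht1 : t ≤ 1) :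
    H (s + t) ≤ H s + t * H (s + 1) := by
  have h := hH.convexOn.2 (mem_Ici.2 hs) (mem_Ici.2 (show 0 ≤ s + 1 by linarith))
    (sub_nonneg.2 ht1) ht0 (by ring)
  simp only [smul_eq_mul] at h
  rw [show (1 - t) * s + t * (s + 1) = s + t by ring] at h
  linarith [mul_nonneg ht0 (hH.nonneg s hs)]

theorem exists_le_add_mul (hH : IsConvexDensity H)
    (hsl : Tendsto (fun x => H x / x) atTop atTop) {t : ℝ} (ht : 0 < t) :
    ∃ M, 0 ≤ M ∧ ∀ y, 0 ≤ y → y ≤ M + t * H y := by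
  obtain ⟨M, hM⟩ := eventually_atTop.1 (hsl.eventually_ge_atTop t⁻¹)
  refine ⟨max M 0, le_max_right _ _, fun y hy => ?_⟩
  have hty := mul_nonneg ht.le (hH.nonneg y hy)
  rcases le_or_gt y (max M 0) with h | h
  · linarith
  · have hy0 : 0 < y := (le_max_right M 0).trans_lt h
    have hHy := hM y ((le_max_left M 0).trans h.le)
    rw [le_div_iff₀ hy0, inv_mul_le_iff₀ ht] at hHy
    linarith [le_max_right M 0]

end IsConvexDensity

/-! ### Particle configurations -/

/-- The distance from the `i`-th particle to its nearest neighbour; it is the length of the ball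
`Bᵢ`. It takes the junk value `0` for a single particle. -/
noncomputable def minGap {N : ℕ} (x : Fin N → ℝ) (i : Fin N) : ℝ :=
  ⨅ j : {j : Fin N // j ≠ i}, |x i - x j|

theorem minGap_le {N : ℕ} (x : Fin N → ℝ) {i j : Fin N} (h : j ≠ i) :
    minGap x i ≤ |x i - x j| :=
  ciInf_le (f := fun j : {j : Fin N // j ≠ i} => |x i - x j|) (finite_range _).bddBelow ⟨j, h⟩

theorem minGap_nonneg {N : ℕ} (x : Fin N → ℝ) (i : Fin N) : 0 ≤ minGap x i :=
  Real.iInf_nonneg fun _ => abs_nonneg _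

theorem exists_minGap_eq {N : ℕ} (hN : 2 ≤ N) (x : Fin N → ℝ) (i : Fin N) :
    ∃ j ≠ i, minGap x i = |x i - x j| := by
  have : Nontrivial (Fin N) := Fin.nontrivial_iff_two_le.2 hN
  have : Nonempty {j : Fin N // j ≠ i} := nonempty_subtype.2 (exists_ne i)
  obtain ⟨j, hj⟩ := exists_eq_ciInf_of_finite (f := fun j : {j : Fin N // j ≠ i} => |x i - x j|)
  exact ⟨j, j.2, hj.symm⟩

theorem minGap_pos {N : ℕ} (hN : 2 ≤ N) {x : Fin N → ℝ} (hx : Function.Injective x) (i : Fin N) :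
    0 < minGap x i := by
  obtain ⟨j, hji, hj⟩ := exists_minGap_eq hN x i
  exact hj ▸ abs_pos.2 (sub_ne_zero.2 fun h => hji (hx h).symm)

theorem add_minGap_le {N : ℕ} {x : Fin N → ℝ} (hx : StrictMono x) {i j : Fin N} (h : i < j) :
    x i + minGap x i ≤ x j := by
  have h_gap := minGap_le x h.ne'
  rw [abs_sub_comm, abs_of_pos (sub_pos.2 (hx h))] at h_gap
  linarith

theorem volume_real_particleBall {N : ℕ} (x : Fin N → ℝ) (i : Fin N) :
    volume.real (particleBall x i) = minGap x i := by
  rw [particleBall, ← minGap, Real.volume_real_ball (div_nonneg (minGap_nonneg x i) zero_le_two),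
    mul_div_cancel₀ _ two_ne_zero]

theorem particleEnergy_eq (H : ℝ → ℝ) {N : ℕ} (x : Fin N → ℝ) :
    particleEnergy H x = ∑ i, minGap x i * H (1 / (N * minGap x i)) := by
  simp only [particleEnergy, volume_real_particleBall]

theorem particleEnergy_le {H : ℝ → ℝ} (hH : IsConvexDensity H) {N : ℕ} (hN : 2 ≤ N)
    {x g : Fin N → ℝ} (hg : ∀ i, 0 < g i) (hgx : ∀ i j, j ≠ i → g i ≤ |x i - x j|) :
    particleEnergy H x ≤ ∑ i, g i * H (1 / (N * g i)) := by
  rw [particleEnergy_eq]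
  refine Finset.sum_le_sum fun i _ => ?_
  obtain ⟨j, hji, hj⟩ := exists_minGap_eq hN x i
  have h_anti := hH.mul_map_div_antitone (w := 1 / N) (hg i) (hj ▸ hgx i j hji) (by positivity)
  simpa only [div_div] using h_anti

open scoped Classical in
theorem empirical_real {N : ℕ} (x : Fin N → ℝ) {s : Set ℝ} (hs : MeasurableSet s) :
    (empirical x).real s = (Finset.univ.filter fun i => x i ∈ s).card / N := by
  simp [empirical, Measure.real, hs, Set.indicator_apply, Finset.sum_boole, div_eq_inv_mul]

theorem exists_subset_sum_minGap_le {N : ℕ} {x : Fin N → ℝ} (hx : StrictMono x) {I : Set ℝ}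
    (hI : I.OrdConnected) (hI_fin : volume I ≠ ∞) {S : Finset (Fin N)} (hS : ∀ i ∈ S, x i ∈ I) :
    ∃ T ⊆ S, S.card ≤ T.card + 1 ∧ ∑ i ∈ T, minGap x i ≤ volume.real I := by
  rcases S.eq_empty_or_nonempty with rfl | hS_ne
  · exact ⟨∅, by simp⟩
  refine ⟨S.erase (S.max' hS_ne), Finset.erase_subset _ _, ?_, ?_⟩
  · rw [Finset.card_erase_of_mem (S.max'_mem hS_ne)]
    omega
  have h_sub : ∀ i ∈ S.erase (S.max' hS_ne), Ico (x i) (x i + minGap x i) ⊆ I := fun i hi y hy =>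
    hI.out (hS i (Finset.mem_of_mem_erase hi)) (hS _ (S.max'_mem hS_ne))
      ⟨hy.1, hy.2.le.trans (add_minGap_le hx (S.lt_max'_of_mem_erase_max' hS_ne hi))⟩
  have h_disj : Pairwise (Function.onFun Disjoint fun i => Ico (x i) (x i + minGap x i)) :=
    (pairwise_disjoint_on _).2 fun i j hij =>
      Ico_disjoint_Ico.2 (min_le_of_left_le (le_max_of_le_right (add_minGap_le hx hij)))
  calc ∑ i ∈ S.erase (S.max' hS_ne), minGap x i
      = ∑ i ∈ S.erase (S.max' hS_ne), volume.real (Ico (x i) (x i + minGap x i)) := by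
        simp [minGap_nonneg]
    _ = volume.real (⋃ i ∈ S.erase (S.max' hS_ne), Ico (x i) (x i + minGap x i)) :=
        (measureReal_biUnion_finset (h_disj.set_pairwise _) (fun _ _ => measurableSet_Ico)
          fun _ _ => by simp).symm
    _ ≤ volume.real I := measureReal_mono (iUnion₂_subset h_sub) hI_fin

theorem mul_map_div_le_sum_minGap {H : ℝ → ℝ} (hH : IsConvexDensity H) {N : ℕ} (hN : 2 ≤ N)
    {x : Fin N → ℝ} (hx : StrictMono x) {I : Set ℝ} (hI : I.OrdConnected)
    (hI_fin : volume I ≠ ∞) {S : Finset (Fin N)} (hS : ∀ i ∈ S, x i ∈ I) :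
    volume.real I * H (max (S.card / N - 1 / N : ℝ) 0 / volume.real I) ≤
      ∑ i ∈ S, minGap x i * H (1 / (N * minGap x i)) := by
  have h_gap : ∀ i, 0 < minGap x i := minGap_pos hN hx.injective
  have h_nonneg : ∀ i, 0 ≤ minGap x i * H (1 / (N * minGap x i)) := fun i =>
    mul_nonneg (h_gap i).le
      (hH.nonneg _ (one_div_nonneg.2 (mul_nonneg N.cast_nonneg (h_gap i).le)))
  obtain ⟨T, hTS, h_card, h_sum⟩ := exists_subset_sum_minGap_le hx hI hI_fin hS
  rcases (measureReal_nonneg (μ := volume) (s := I)).eq_or_lt with hV | hV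
  · simpa [← hV] using Finset.sum_nonneg fun i _ => h_nonneg i
  have h_mass : max (S.card / N - 1 / N : ℝ) 0 ≤ ∑ i ∈ T, (1 / N : ℝ) := by
    have : (S.card : ℝ) ≤ T.card + 1 := by exact_mod_cast h_card
    rw [Finset.sum_const, nsmul_eq_mul, mul_one_div, ← sub_div]
    exact max_le (by gcongr; linarith) (by positivity)
  calc volume.real I * H (max (S.card / N - 1 / N : ℝ) 0 / volume.real I)
      ≤ volume.real I * H ((∑ i ∈ T, (1 / N : ℝ)) / volume.real I) := by
        gcongr
        exact hH.monotoneOn (mem_Ici.2 (by positivity)) (mem_Ici.2 (by positivity)) (by gcongr)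
    _ ≤ ∑ i ∈ T, minGap x i * H (1 / N / minGap x i) :=
        hH.mul_map_sum_div_le (fun i _ => h_gap i) (fun _ _ => by positivity) hV h_sum
    _ ≤ ∑ i ∈ S, minGap x i * H (1 / (N * minGap x i)) := by
        simp only [div_div]
        exact Finset.sum_le_sum_of_subset_of_nonneg hTS fun i _ _ => h_nonneg i

theorem sum_mul_map_le_particleEnergy {H : ℝ → ℝ} (hH : IsConvexDensity H) {N : ℕ} (hN : 2 ≤ N)
    {x : Fin N → ℝ} (hx : StrictMono x) {T : Finset (Set ℝ)} (hT : ∀ I ∈ T, I.OrdConnected)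
    (hT_fin : ∀ I ∈ T, volume I ≠ ∞) (hT_disj : (T : Set (Set ℝ)).PairwiseDisjoint id) :
    ∑ I ∈ T, volume.real I * H (max ((empirical x).real I - 1 / N) 0 / volume.real I) ≤
      particleEnergy H x := by
  classical
  let S : Set ℝ → Finset (Fin N) := fun I => Finset.univ.filter fun i => x i ∈ I
  have hS_disj : (T : Set (Set ℝ)).PairwiseDisjoint S := fun I hI J hJ hIJ =>
    Finset.disjoint_filter.2 fun i _ hi hi' =>
      (hT_disj hI hJ hIJ).le_bot ⟨hi, hi'⟩
  calc ∑ I ∈ T, volume.real I * H (max ((empirical x).real I - 1 / N) 0 / volume.real I)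
      ≤ ∑ I ∈ T, ∑ i ∈ S I, minGap x i * H (1 / (N * minGap x i)) := by
        refine Finset.sum_le_sum fun I hI => ?_
        rw [empirical_real x (hT I hI).measurableSet]
        exact mul_map_div_le_sum_minGap hH hN hx (hT I hI) (hT_fin I hI)
          fun i hi => (Finset.mem_filter.1 hi).2
    _ = ∑ i ∈ T.biUnion S, minGap x i * H (1 / (N * minGap x i)) :=
        (Finset.sum_biUnion hS_disj).symm
    _ ≤ particleEnergy H x := by
        rw [particleEnergy_eq]
        refine Finset.sum_le_univ_sum_of_nonneg fun i => mul_nonneg (minGap_nonneg x i) ?_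
        exact hH.nonneg _ (one_div_nonneg.2 (mul_nonneg N.cast_nonneg (minGap_nonneg x i)))

/-! ### The lower bound -/

theorem isProbabilityMeasure_empirical {N : ℕ} (hN : N ≠ 0) (x : Fin N → ℝ) :
    IsProbabilityMeasure (empirical x) := by
  constructor
  simp [empirical, ENNReal.inv_mul_cancel, hN]

theorem ofReal_mul_rpow_le_wassersteinDist {p : ℝ} (hp : 0 < p) (μ ρ : Measure ℝ) (ε : ℝ)
    {s : Set ℝ} (hs : MeasurableSet s) :
    ENNReal.ofReal ε * (ρ s - μ (Metric.thickening ε s)) ^ (1 / p) ≤ wassersteinDist p μ ρ := by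
  refine le_iInf₂ fun π ⟨_, hπμ, hπρ⟩ => ?_
  let far : Set (ℝ × ℝ) := {z | ENNReal.ofReal ε ^ p ≤ edist z.1 z.2 ^ p}
  have h_cover : Prod.snd ⁻¹' s ⊆ Prod.fst ⁻¹' Metric.thickening ε s ∪ far := by
    intro z hz
    by_contra! h
    rw [mem_union, not_or] at h
    refine h.1 (Metric.mem_thickening_iff.2 ⟨z.2, hz, ?_⟩)
    have h_near := lt_of_not_ge fun hε => h.2 (ENNReal.rpow_le_rpow hε hp.le)
    rw [edist_dist] at h_near
    exact (ENNReal.ofReal_lt_ofReal_iff_of_nonneg dist_nonneg).1 h_near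
  have h_far : ρ s - μ (Metric.thickening ε s) ≤ π far := by
    rw [tsub_le_iff_left, ← hπμ, ← hπρ, Measure.map_apply measurable_snd hs,
      Measure.map_apply measurable_fst Metric.isOpen_thickening.measurableSet]
    exact (measure_mono h_cover).trans (measure_union_le _ _)
  have h_markov : ENNReal.ofReal ε ^ p * π far ≤ ∫⁻ z, edist z.1 z.2 ^ p ∂π :=
    mul_meas_ge_le_lintegral (by fun_prop) _
  calc ENNReal.ofReal ε * (ρ s - μ (Metric.thickening ε s)) ^ (1 / p)
      ≤ ENNReal.ofReal ε * π far ^ (1 / p) := by gcongr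
    _ = (ENNReal.ofReal ε ^ p * π far) ^ (1 / p) := by
        rw [ENNReal.mul_rpow_of_nonneg _ _ (by positivity), ← ENNReal.rpow_mul,
          mul_one_div_cancel hp.ne', ENNReal.rpow_one]
    _ ≤ (∫⁻ z, edist z.1 z.2 ^ p ∂π) ^ (1 / p) := by gcongr

section Portmanteau

variable {p : ℝ} {ι : Type*} {l : Filter ι} {μ : ι → Measure ℝ} {ρ : Measure ℝ}

theorem eventually_lt_measure_of_isOpen [IsFiniteMeasure ρ] (hp : 0 < p)
    (hW : Tendsto (fun i => wassersteinDist p (μ i) ρ) l (𝓝 0)) {G : Set ℝ} (hG : IsOpen G)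
    {c : ℝ≥0∞} (hc : c < ρ G) : ∀ᶠ i in l, c < μ i G := by
  obtain ⟨K, hKG, hK, hcK⟩ := hG.exists_lt_isCompact hc
  obtain ⟨ε, hε, hεG⟩ := hK.exists_thickening_subset_open hG hKG
  have h_pos : 0 < ENNReal.ofReal ε * (ρ K - c) ^ (1 / p) :=
    ENNReal.mul_pos (by simpa) (ENNReal.rpow_pos (tsub_pos_of_lt hcK) (by finiteness)).ne'
  filter_upwards [hW.eventually_lt_const h_pos] with i hi
  by_contra! hμc
  refine hi.not_ge (le_trans ?_ (ofReal_mul_rpow_le_wassersteinDist hp _ _ ε hK.measurableSet))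
  gcongr
  exact (measure_mono hεG).trans hμc

theorem eventually_sub_lt_measureReal_of_isOpen [IsFiniteMeasure ρ] (hp : 0 < p)
    (hμ : ∀ᶠ i in l, IsFiniteMeasure (μ i))
    (hW : Tendsto (fun i => wassersteinDist p (μ i) ρ) l (𝓝 0)) {G : Set ℝ} (hG : IsOpen G)
    {η : ℝ} (hη : 0 < η) : ∀ᶠ i in l, ρ.real G - η < (μ i).real G := by
  rcases lt_or_ge (ρ.real G - η) 0 with h | h
  · exact .of_forall fun i => h.trans_le measureReal_nonneg
  have hc : ENNReal.ofReal (ρ.real G - η) < ρ G :=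
    (ENNReal.ofReal_lt_iff_lt_toReal h (measure_ne_top _ _)).2 (sub_lt_self _ hη)
  filter_upwards [hμ, eventually_lt_measure_of_isOpen hp hW hG hc] with i _ hi
  exact (ENNReal.ofReal_lt_iff_lt_toReal h (measure_ne_top _ _)).1 hi

end Portmanteau

/-- The energy on the set `I` of the measure that spreads the mass `ρ I` uniformly over `I`;
it is `0` if `I` has zero or infinite length. -/
noncomputable def cellEnergy (H : ℝ → ℝ) (ρ : Measure ℝ) (I : Set ℝ) : ℝ :=
  volume.real I * H (ρ.real I / volume.real I)

/-- A finite family of pairwise disjoint open intervals of finite length. -/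
structure IsIntervalFamily (T : Finset (Set ℝ)) : Prop where
  isOpen : ∀ I ∈ T, IsOpen I
  ordConnected : ∀ I ∈ T, I.OrdConnected
  volume_ne_top : ∀ I ∈ T, volume I ≠ ∞
  pairwiseDisjoint : (T : Set (Set ℝ)).PairwiseDisjoint id

/-- The supremum of the total cell energies of `ρ` over finite families of disjoint open intervals.
It makes sense for every measure and is the common intermediary between the discrete energies and
the continuum energy. -/
noncomputable def intervalEnergy (H : ℝ → ℝ) (ρ : Measure ℝ) : ℝ≥0∞ :=
  ⨆ T ∈ {T : Finset (Set ℝ) | IsIntervalFamily T}, ENNReal.ofReal (∑ I ∈ T, cellEnergy H ρ I)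

theorem IsConvexDensity.cellEnergy_nonneg {H : ℝ → ℝ} (hH : IsConvexDensity H) (ρ : Measure ℝ)
    (I : Set ℝ) : 0 ≤ cellEnergy H ρ I :=
  mul_nonneg measureReal_nonneg (hH.nonneg _ (by positivity))

theorem ofReal_sum_mul_map_le_liminf_discreteEnergy {H : ℝ → ℝ} (hH : IsConvexDensity H) {p : ℝ}
    (hp : 0 < p) {Ω : Set ℝ} {μ : ℕ → Measure ℝ} (hμ : ∀ N, 2 ≤ N → μ N ∈ Atomic N Ω)
    {ρ : Measure ℝ} [IsFiniteMeasure ρ]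
    (hW : Tendsto (fun N => wassersteinDist p (μ N) ρ) atTop (𝓝 0)) {T : Finset (Set ℝ)}
    (hT : IsIntervalFamily T) {η : ℝ} (hη : 0 < η) :
    ENNReal.ofReal (∑ I ∈ T, volume.real I * H (max (ρ.real I - η) 0 / volume.real I)) ≤
      liminf (fun N => discreteEnergy H N (μ N)) atTop := by
  have h_fin : ∀ᶠ N in atTop, IsFiniteMeasure (μ N) := by
    filter_upwards [eventually_ge_atTop 2] with N hN
    obtain ⟨x, -, -, hx⟩ := hμ N hN
    have := isProbabilityMeasure_empirical (by omega) x
    rw [hx]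
    infer_instance
  have h_mass : ∀ᶠ N in atTop, ∀ I ∈ T, ρ.real I - η / 2 < (μ N).real I :=
    (Finset.eventually_all T).2 fun I hI =>
      eventually_sub_lt_measureReal_of_isOpen hp h_fin hW (hT.isOpen I hI) (half_pos hη)
  refine le_liminf_of_le (by isBoundedDefault) ?_
  filter_upwards [h_mass, eventually_ge_atTop 2,
    (tendsto_one_div_atTop_nhds_zero_nat (𝕜 := ℝ)).eventually_lt_const (half_pos hη)]
    with N hN hN2 hN_inv
  obtain ⟨x, hx, -, hμx⟩ := hμ N hN2
  rw [hμx, discreteEnergy_empirical H hx]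
  rw [hμx] at hN
  refine ENNReal.ofReal_le_ofReal (le_trans (Finset.sum_le_sum fun I hI => ?_)
    (sum_mul_map_le_particleEnergy hH hN2 hx hT.ordConnected hT.volume_ne_top
      hT.pairwiseDisjoint))
  gcongr
  refine hH.monotoneOn (mem_Ici.2 (by positivity)) (mem_Ici.2 (by positivity)) ?_
  gcongr ?_ / _
  exact max_le_max_right 0 (by linarith [hN I hI])

theorem intervalEnergy_le_liminf_discreteEnergy {H : ℝ → ℝ} (hH : IsConvexDensity H) {p : ℝ}
    (hp : 0 < p) {Ω : Set ℝ} {μ : ℕ → Measure ℝ} (hμ : ∀ N, 2 ≤ N → μ N ∈ Atomic N Ω)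
    {ρ : Measure ℝ} [IsFiniteMeasure ρ]
    (hW : Tendsto (fun N => wassersteinDist p (μ N) ρ) atTop (𝓝 0)) :
    intervalEnergy H ρ ≤ liminf (fun N => discreteEnergy H N (μ N)) atTop := by
  refine iSup₂_le fun T hT => ?_
  have h_mass : ∀ I, Tendsto (fun η => max (ρ.real I - η) 0 / volume.real I) (𝓝[>] 0)
      (𝓝 (ρ.real I / volume.real I)) := fun I => by
    have : Continuous fun η => max (ρ.real I - η) 0 / volume.real I := by fun_prop
    simpa using (this.tendsto 0).mono_left nhdsWithin_le_nhds
  have h_lim : Tendsto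
      (fun η => ENNReal.ofReal (∑ I ∈ T, volume.real I * H (max (ρ.real I - η) 0 / volume.real I)))
      (𝓝[>] 0) (𝓝 (ENNReal.ofReal (∑ I ∈ T, cellEnergy H ρ I))) :=
    ENNReal.tendsto_ofReal (tendsto_finsetSum _ fun I _ =>
      (hH.tendsto_comp (fun η => by positivity) (by positivity) (h_mass I)).const_mul _)
  exact le_of_tendsto h_lim (eventually_mem_nhdsWithin.mono fun η hη =>
    ofReal_sum_mul_map_le_liminf_discreteEnergy hH hp hμ hW hT hη)

theorem exists_isIntervalFamily_cover {U K : Set ℝ} (hU : IsOpen U) (hU_fin : volume U ≠ ∞)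
    (hK : IsCompact K) (hKU : K ⊆ U) :
    ∃ T : Finset (Set ℝ), IsIntervalFamily T ∧ (∀ I ∈ T, I ⊆ U) ∧ K ⊆ ⋃ I ∈ T, I := by
  classical
  obtain ⟨t, htK⟩ := hK.elim_nhds_subcover' (fun x _ => connectedComponentIn U x)
    fun x hx => hU.connectedComponentIn.mem_nhds (mem_connectedComponentIn (hKU hx))
  have h_sub : ∀ x, connectedComponentIn U x ⊆ U := connectedComponentIn_subset U
  refine ⟨t.image fun x : K => connectedComponentIn U x, ⟨?_, ?_, ?_, ?_⟩, ?_, ?_⟩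
  · exact Finset.forall_mem_image.2 fun _ _ => hU.connectedComponentIn
  · exact Finset.forall_mem_image.2 fun _ _ => isPreconnected_connectedComponentIn.ordConnected
  · exact Finset.forall_mem_image.2 fun x _ => measure_ne_top_of_subset (h_sub x) hU_fin
  · rintro I hI J hJ hIJ
    obtain ⟨x, -, rfl⟩ := Finset.mem_image.1 hI
    obtain ⟨y, -, rfl⟩ := Finset.mem_image.1 hJ
    refine disjoint_left.2 fun z hzx hzy => hIJ ?_
    exact (connectedComponentIn_eq hzx).trans (connectedComponentIn_eq hzy).symm
  · exact Finset.forall_mem_image.2 fun x _ => h_sub x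
  · simpa using htK

section AbsolutelyContinuous

variable {H : ℝ → ℝ} {ρ : Measure ℝ}

theorem IsIntervalFamily.sum_cellEnergy_le {T : Finset (Set ℝ)} (hT : IsIntervalFamily T)
    (hE : intervalEnergy H ρ ≠ ∞) :
    ∑ I ∈ T, cellEnergy H ρ I ≤ (intervalEnergy H ρ).toReal :=
  (ENNReal.ofReal_le_iff_le_toReal hE).1
    (le_iSup₂ (f := fun (T : Finset (Set ℝ)) (_ : T ∈ {T | IsIntervalFamily T}) =>
      ENNReal.ofReal (∑ I ∈ T, cellEnergy H ρ I)) T hT)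

theorem measureReal_le_add_mul_cellEnergy {I : Set ℝ} (hI : IsOpen I)
    (hI_fin : volume I ≠ ∞) {M t : ℝ} (hM : ∀ y, 0 ≤ y → y ≤ M + t * H y) :
    ρ.real I ≤ M * volume.real I + t * cellEnergy H ρ I := by
  rcases (measureReal_nonneg (μ := volume) (s := I)).eq_or_lt with hV | hV
  · have h_null : volume I = 0 := (measureReal_eq_zero_iff hI_fin).1 hV.symm
    simp [(hI.measure_eq_zero_iff volume).1 h_null, cellEnergy]
  · calc ρ.real I = volume.real I * (ρ.real I / volume.real I) := by field_simp
      _ ≤ volume.real I * (M + t * H (ρ.real I / volume.real I)) := by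
        gcongr
        exact hM _ (by positivity)
      _ = M * volume.real I + t * cellEnergy H ρ I := by
        rw [cellEnergy]
        ring

theorem measure_le_ofReal_of_isOpen [IsFiniteMeasure ρ] {U : Set ℝ} (hU : IsOpen U)
    (hU_fin : volume U ≠ ∞) (hE : intervalEnergy H ρ ≠ ∞) {M t : ℝ} (hM0 : 0 ≤ M) (ht : 0 ≤ t)
    (hM : ∀ y, 0 ≤ y → y ≤ M + t * H y) :
    ρ U ≤ ENNReal.ofReal (M * volume.real U + t * (intervalEnergy H ρ).toReal) := by
  refine le_of_forall_lt fun c hc => ?_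
  obtain ⟨K, hKU, hK, hcK⟩ := hU.exists_lt_isCompact hc
  obtain ⟨T, hT, hTU, hKT⟩ := exists_isIntervalFamily_cover hU hU_fin hK hKU
  have h_vol : ∑ I ∈ T, volume.real I ≤ volume.real U := by
    have h_union := measureReal_biUnion_finset hT.pairwiseDisjoint
      (fun I hI => (hT.isOpen I hI).measurableSet) hT.volume_ne_top
    exact h_union.symm.trans_le (measureReal_mono (iUnion₂_subset hTU) hU_fin)
  have h_mass : ρ.real K ≤ M * volume.real U + t * (intervalEnergy H ρ).toReal :=
    calc ρ.real K ≤ ρ.real (⋃ I ∈ T, I) := measureReal_mono hKT (measure_ne_top _ _)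
      _ ≤ ∑ I ∈ T, ρ.real I := measureReal_biUnion_finset_le T _
      _ ≤ ∑ I ∈ T, (M * volume.real I + t * cellEnergy H ρ I) :=
        Finset.sum_le_sum fun I hI =>
          measureReal_le_add_mul_cellEnergy (hT.isOpen I hI) (hT.volume_ne_top I hI) hM
      _ = M * ∑ I ∈ T, volume.real I + t * ∑ I ∈ T, cellEnergy H ρ I := by
        rw [Finset.sum_add_distrib, Finset.mul_sum, Finset.mul_sum]
      _ ≤ M * volume.real U + t * (intervalEnergy H ρ).toReal := by
        gcongr
        exact hT.sum_cellEnergy_le hE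
  exact hcK.trans_le ((ENNReal.le_ofReal_iff_toReal_le (measure_ne_top _ _)
    (measureReal_nonneg.trans h_mass)).2 h_mass)

-- Superlinear growth prevents mass from concentrating on sets of small length.
theorem absolutelyContinuous_of_intervalEnergy_ne_top [IsFiniteMeasure ρ]
    (hH : IsConvexDensity H) (hsl : Tendsto (fun x => H x / x) atTop atTop)
    (hE : intervalEnergy H ρ ≠ ∞) :
    ρ ≪ volume := by
  intro s hs
  refine (measureReal_eq_zero_iff).1 (le_antisymm (le_of_forall_pos_le_add fun ε hε => ?_)
    measureReal_nonneg)
  set Λ := (intervalEnergy H ρ).toReal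
  have : 0 ≤ Λ := ENNReal.toReal_nonneg
  let t := ε / 2 / (Λ + 1)
  obtain ⟨M, hM0, hM⟩ := hH.exists_le_add_mul hsl (show 0 < t by positivity)
  let δ := ε / 2 / (M + 1)
  obtain ⟨U, hsU, hU, hUδ⟩ := s.exists_isOpen_lt_of_lt (ENNReal.ofReal δ)
    (by rw [hs]; exact ENNReal.ofReal_pos.2 (by positivity))
  have h_vol : volume.real U ≤ δ := ENNReal.toReal_le_of_le_ofReal (by positivity) hUδ.le
  have h_density : M * volume.real U ≤ ε / 2 :=
    calc M * volume.real U ≤ (M + 1) * δ := by gcongr; linarith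
      _ = ε / 2 := mul_div_cancel₀ _ (by positivity)
  have h_energy : t * Λ ≤ ε / 2 :=
    calc t * Λ ≤ t * (Λ + 1) := by gcongr; linarith
      _ = ε / 2 := div_mul_cancel₀ _ (by positivity)
  calc ρ.real s ≤ ρ.real U := measureReal_mono hsU
    _ ≤ M * volume.real U + t * Λ := ENNReal.toReal_le_of_le_ofReal (by positivity)
        (measure_le_ofReal_of_isOpen hU hUδ.ne_top hE hM0 (by positivity) hM)
    _ ≤ 0 + ε := by linarith

end AbsolutelyContinuous

section Grid

variable {L : ℝ}

/-- The `k`-th open cell of the grid of mesh `L` on the line. -/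
def gridCell (L : ℝ) (k : ℤ) : Set ℝ :=
  Ioo (k * L) ((k + 1) * L)

theorem volume_real_gridCell (hL : 0 ≤ L) (k : ℤ) : volume.real (gridCell L k) = L := by
  rw [gridCell, Real.volume_real_Ioo_of_le (by linarith)]
  ring

theorem pairwise_disjoint_gridCell (hL : 0 ≤ L) :
    Pairwise (Function.onFun Disjoint (gridCell L)) := by
  refine (pairwise_disjoint_on _).2 fun j k hjk => ?_
  have : ((j : ℝ) + 1) * L ≤ k * L := mul_le_mul_of_nonneg_right (by exact_mod_cast hjk) hL
  exact Ioo_disjoint_Ioo.2 (min_le_of_left_le (le_max_of_le_right this))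

theorem lintegral_comp_floor_div (hL : 0 < L) (f : ℤ → ℝ≥0∞) :
    ∫⁻ x : ℝ, f ⌊x / L⌋ = ∑' k, f k * ENNReal.ofReal L := by
  have h_meas : Measurable fun x : ℝ => ⌊x / L⌋ := by fun_prop
  rw [← lintegral_map (measurable_from_top (f := f)) h_meas, lintegral_countable']
  refine tsum_congr fun k => ?_
  have h_fiber : (fun x : ℝ => ⌊x / L⌋) ⁻¹' {k} = Ico (k * L) ((k + 1) * L) := by
    ext x
    rw [mem_preimage, mem_singleton_iff, Int.floor_eq_iff, le_div_iff₀ hL, div_lt_iff₀ hL, mem_Ico]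
  rw [Measure.map_apply h_meas (measurableSet_singleton k), h_fiber, Real.volume_Ico]
  congr 2
  ring

theorem lintegral_gridCell_le_intervalEnergy {H : ℝ → ℝ} (hH : IsConvexDensity H)
    (ρ : Measure ℝ) (hL : 0 < L) :
    ∫⁻ x, ENNReal.ofReal (H (ρ.real (gridCell L ⌊x / L⌋) / L)) ≤ intervalEnergy H ρ := by
  classical
  have h_disj := pairwise_disjoint_gridCell hL.le
  have h_inj : Function.Injective (gridCell L) := fun j k hjk => by
    by_contra hne
    have h_empty : Disjoint (gridCell L j) (gridCell L j) := by
      nth_rewrite 2 [hjk]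
      exact h_disj hne
    have h_vol := volume_real_gridCell hL.le j
    rw [disjoint_self.1 h_empty, bot_eq_empty, measureReal_empty] at h_vol
    exact hL.ne h_vol
  have h_cell : ∀ k, ENNReal.ofReal (H (ρ.real (gridCell L k) / L)) * ENNReal.ofReal L =
      ENNReal.ofReal (cellEnergy H ρ (gridCell L k)) := fun k => by
    rw [cellEnergy, volume_real_gridCell hL.le, mul_comm L,
      ENNReal.ofReal_mul (hH.nonneg _ (by positivity))]
  rw [lintegral_comp_floor_div hL fun k => ENNReal.ofReal (H (ρ.real (gridCell L k) / L)),
    ENNReal.tsum_eq_iSup_sum]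
  refine iSup_le fun T => ?_
  have h_family : IsIntervalFamily (T.image (gridCell L)) := by
    refine ⟨?_, ?_, ?_, ?_⟩
    · exact Finset.forall_mem_image.2 fun _ _ => isOpen_Ioo
    · exact Finset.forall_mem_image.2 fun _ _ => ordConnected_Ioo
    · exact Finset.forall_mem_image.2 fun _ _ => by simp [gridCell]
    · rw [Finset.coe_image, h_inj.injOn.pairwiseDisjoint_image]
      exact h_disj.set_pairwise _
  simp_rw [h_cell]
  rw [← ENNReal.ofReal_sum_of_nonneg fun _ _ => hH.cellEnergy_nonneg _ _,
    ← Finset.sum_image (f := cellEnergy H ρ) h_inj.injOn]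
  exact le_iSup₂_of_le _ h_family le_rfl

end Grid

theorem ae_tendsto_measureReal_gridCell_div {ρ : Measure ℝ} [IsFiniteMeasure ρ]
    (hρ : ρ ≪ volume) {L : ℕ → ℝ} (hL : ∀ n, 0 < L n) (hL0 : Tendsto L atTop (𝓝 0)) :
    ∀ᵐ x, Tendsto (fun n => ρ.real (gridCell (L n) ⌊x / L n⌋) / L n) atTop
      (𝓝 (ρ.rnDeriv volume x).toReal) := by
  have h_int : Integrable fun x => (ρ.rnDeriv volume x).toReal :=
    Measure.integrable_toReal_rnDeriv
  have h_center : ∀ n (k : ℤ), Metric.closedBall ((k + 1 / 2) * L n) (L n / 2) =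
      Icc (k * L n) ((k + 1) * L n) := fun n k => by
    rw [Real.closedBall_eq_Icc]
    congr 1 <;> ring
  have h_radius : Tendsto (fun n => L n / 2) atTop (𝓝[>] 0) :=
    tendsto_nhdsWithin_iff.2 ⟨by simpa using hL0.div_const 2, .of_forall fun n => half_pos (hL n)⟩
  filter_upwards [IsUnifLocDoublingMeasure.ae_tendsto_average volume h_int.locallyIntegrable 1]
    with x hx
  have h_mem : ∀ n, x ∈ Metric.closedBall ((⌊x / L n⌋ + 1 / 2) * L n) (1 * (L n / 2)) := fun n => by
    rw [one_mul, h_center]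
    exact ⟨(le_div_iff₀ (hL n)).1 (Int.floor_le _),
      ((div_lt_iff₀ (hL n)).1 (Int.lt_floor_add_one _)).le⟩
  refine (hx (l := atTop) _ _ h_radius (.of_forall h_mem)).congr fun n => ?_
  rw [h_center, setAverage_eq, Measure.setIntegral_toReal_rnDeriv hρ, smul_eq_mul,
    ← div_eq_inv_mul, ← measureReal_congr (hρ.ae_le Ioo_ae_eq_Icc),
    ← measureReal_congr (μ := volume) Ioo_ae_eq_Icc, ← gridCell, volume_real_gridCell (hL n).le]

theorem energy_le_intervalEnergy {H : ℝ → ℝ} (hH : IsConvexDensity H)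
    (hsl : Tendsto (fun x => H x / x) atTop atTop) (Ω : Set ℝ) (ρ : Measure ℝ)
    [IsFiniteMeasure ρ] : energy H Ω ρ ≤ intervalEnergy H ρ := by
  rcases eq_or_ne (intervalEnergy H ρ) ∞ with h_top | h_top
  · exact h_top ▸ le_top
  have hρ := absolutelyContinuous_of_intervalEnergy_ne_top hH hsl h_top
  let L : ℕ → ℝ := fun n => 1 / ((n : ℝ) + 1)
  have hL : ∀ n, 0 < L n := fun n => Nat.one_div_pos_of_nat
  let h : ℕ → ℝ → ℝ≥0∞ := fun n x =>
    ENNReal.ofReal (H (ρ.real (gridCell (L n) ⌊x / L n⌋) / L n))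
  have h_meas : ∀ n, Measurable (h n) := fun n =>
    (measurable_from_top (f := fun k : ℤ =>
      ENNReal.ofReal (H (ρ.real (gridCell (L n) k) / L n)))).comp (by fun_prop)
  have h_lim : ∀ᵐ x, Tendsto (fun n => h n x) atTop
      (𝓝 (ENNReal.ofReal (H (ρ.rnDeriv volume x).toReal))) := by
    filter_upwards [ae_tendsto_measureReal_gridCell_div hρ hL
      tendsto_one_div_add_atTop_nhds_zero_nat] with x hx
    exact ENNReal.tendsto_ofReal (hH.tendsto_comp
      (fun n => div_nonneg measureReal_nonneg (hL n).le) ENNReal.toReal_nonneg hx)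
  calc energy H Ω ρ ≤ ∫⁻ x, ENNReal.ofReal (H (ρ.rnDeriv volume x).toReal) := by
        rw [energy, if_pos hρ]
        exact setLIntegral_le_lintegral _ _
    _ = ∫⁻ x, liminf (fun n => h n x) atTop :=
        lintegral_congr_ae (h_lim.mono fun x hx => hx.liminf_eq.symm)
    _ ≤ liminf (fun n => ∫⁻ x, h n x) atTop := lintegral_liminf_le h_meas
    _ ≤ intervalEnergy H ρ := liminf_le_of_le (by isBoundedDefault) fun b hb => by
        obtain ⟨n, hn⟩ := hb.exists
        exact hn.trans (lintegral_gridCell_le_intervalEnergy hH ρ (hL n))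

/-! ### The upper bound -/

theorem exists_equiv_strictMono_comp {ι : Type*} [Fintype ι] {N : ℕ} (hι : Fintype.card ι = N)
    {X : ι → ℝ} (hX : Function.Injective X) : ∃ e : Fin N ≃ ι, StrictMono (X ∘ e) := by
  let e₀ := (Fintype.equivFinOfCardEq hι).symm
  let e := (Tuple.sort (X ∘ e₀)).trans e₀
  exact ⟨e, (Tuple.monotone_sort (X ∘ e₀)).strictMono_of_injective (hX.comp e.injective)⟩

theorem wassersteinDist_rpow_le_lintegral {p : ℝ} (hp : 0 < p) {μ ν : Measure ℝ}
    {π : Measure (ℝ × ℝ)} (hπ : π ∈ Couplings μ ν) :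
    wassersteinDist p μ ν ^ p ≤ ∫⁻ z, edist z.1 z.2 ^ p ∂π := by
  have h : wassersteinDist p μ ν ≤ (∫⁻ z, edist z.1 z.2 ^ p ∂π) ^ (1 / p) := iInf₂_le π hπ
  rwa [one_div, ENNReal.le_rpow_inv_iff hp] at h

theorem wassersteinDist_rpow_sum_dirac_le {p : ℝ} (hp : 0 < p) {ι : Type*} [Fintype ι]
    (x : ι → ℝ) (σ : ι → Measure ℝ) [∀ i, SFinite (σ i)]
    (hσ : IsProbabilityMeasure (∑ i, σ i)) :
    wassersteinDist p (∑ i, σ i univ • Measure.dirac (x i)) (∑ i, σ i) ^ p ≤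
      ∑ i, ∫⁻ y, edist (x i) y ^ p ∂σ i := by
  let π : Measure (ℝ × ℝ) := ∑ i, (Measure.dirac (x i)).prod (σ i)
  have h_fst : π.map Prod.fst = ∑ i, σ i univ • Measure.dirac (x i) := by
    ext s hs
    simp [π, Measure.map_apply measurable_fst hs, ← prod_univ, Measure.prod_prod, mul_comm]
  have h_snd : π.map Prod.snd = ∑ i, σ i := by
    ext s hs
    simp [π, Measure.map_apply measurable_snd hs, ← univ_prod, Measure.prod_prod]
  have h_prob : IsProbabilityMeasure π := by
    rw [← h_snd] at hσ
    exact Measure.isProbabilityMeasure_of_map Prod.snd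
  refine (wassersteinDist_rpow_le_lintegral hp ⟨h_prob, h_fst, h_snd⟩).trans_eq ?_
  have h_meas : Measurable fun z : ℝ × ℝ => edist z.1 z.2 ^ p := by fun_prop
  rw [lintegral_finsetSum_measure]
  refine Finset.sum_congr rfl fun i _ => ?_
  rw [lintegral_prod _ h_meas.aemeasurable, lintegral_dirac' _ h_meas.lintegral_prod_right']

section Cells

variable {c L : ℝ} {K : ℕ}

/-- The `k`-th closed cell of the grid of mesh `L` starting at `c`. -/
def closedCell (c L : ℝ) (k : ℕ) : Set ℝ :=
  Icc (c + L * k) (c + L * (k + 1))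

/-- The `n k` interior points that divide the `k`-th cell into `n k + 1` equal parts, for every
`k < K`. Staying away from the end points of the cells keeps the gap between particles of different
cells as large as the gap within either cell. -/
noncomputable def cellPoint (c L : ℝ) (n : Fin K → ℕ) (a : Σ k, Fin (n k)) : ℝ :=
  c + L * (a.1 + (a.2 + 1) / (n a.1 + 1))

theorem cellPoint_mem_Icc (hL : 0 ≤ L) (n : Fin K → ℕ) (a : Σ k, Fin (n k)) :
    cellPoint c L n a ∈
      Icc (c + L * a.1 + L / (n a.1 + 1)) (c + L * (a.1 + 1) - L / (n a.1 + 1)) := by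
  have h_last : (a.2 : ℝ) + 1 ≤ n a.1 := by exact_mod_cast a.2.isLt
  have h_first : (0 : ℝ) ≤ (a.2 : ℕ) := Nat.cast_nonneg _
  constructor
  · calc c + L * a.1 + L / (n a.1 + 1) = c + L * (a.1 + (0 + 1) / (n a.1 + 1)) := by ring
      _ ≤ cellPoint c L n a := by
        rw [cellPoint]
        gcongr
  · calc cellPoint c L n a ≤ c + L * (a.1 + n a.1 / (n a.1 + 1)) := by
          rw [cellPoint]
          gcongr
      _ = c + L * (a.1 + 1) - L / (n a.1 + 1) := by
        field_simp
        ring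

theorem cellPoint_mem_closedCell (hL : 0 ≤ L) (n : Fin K → ℕ) (a : Σ k, Fin (n k)) :
    cellPoint c L n a ∈ closedCell c L a.1 := by
  have h_gap : 0 ≤ L / ((n a.1 : ℝ) + 1) := by positivity
  obtain ⟨h_left, h_right⟩ := cellPoint_mem_Icc (c := c) hL n a
  exact ⟨by linarith, by linarith⟩

theorem div_le_abs_cellPoint_sub (hL : 0 ≤ L) (n : Fin K → ℕ) {a b : Σ k, Fin (n k)}
    (hab : a ≠ b) : L / (n a.1 + 1) ≤ |cellPoint c L n a - cellPoint c L n b| := by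
  have h_gap : ∀ k, 0 ≤ L / ((n k : ℝ) + 1) := fun k => by positivity
  obtain ⟨ha_left, ha_right⟩ := cellPoint_mem_Icc (c := c) hL n a
  obtain ⟨hb_left, hb_right⟩ := cellPoint_mem_Icc (c := c) hL n b
  rcases lt_trichotomy a.1 b.1 with h | h | h
  · have h_cells : L * ((a.1 : ℝ) + 1) ≤ L * b.1 :=
      mul_le_mul_of_nonneg_left (by exact_mod_cast h) hL
    exact le_abs.2 (.inr (by linarith [h_gap b.1]))
  · obtain ⟨k, i⟩ := a
    obtain ⟨k', j⟩ := b
    obtain rfl : k = k' := h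
    have hij : (1 : ℝ) ≤ |(i : ℝ) - j| := by
      have : (i : ℤ) - j ≠ 0 := fun h => hab (by congr 1; ext; omega)
      exact_mod_cast Int.one_le_abs this
    calc L / ((n k : ℝ) + 1) ≤ L / (n k + 1) * |(i : ℝ) - j| :=
          le_mul_of_one_le_right (h_gap k) hij
      _ = |L / (n k + 1) * ((i : ℝ) - j)| := by rw [abs_mul, abs_of_nonneg (h_gap k)]
      _ = |cellPoint c L n ⟨k, i⟩ - cellPoint c L n ⟨k, j⟩| := by
        congr 1
        simp only [cellPoint]
        ring
  · have h_cells : L * ((b.1 : ℝ) + 1) ≤ L * a.1 :=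
      mul_le_mul_of_nonneg_left (by exact_mod_cast h) hL
    exact le_abs.2 (.inl (by linarith [h_gap b.1]))

theorem cellPoint_injective (hL : 0 < L) (n : Fin K → ℕ) :
    Function.Injective (cellPoint c L n) := by
  intro a b hab
  by_contra hne
  have h_gap : 0 < L / ((n a.1 : ℝ) + 1) := by positivity
  have h_le := div_le_abs_cellPoint_sub (c := c) hL.le n hne
  rw [hab, sub_self, abs_zero] at h_le
  exact h_gap.not_ge h_le

theorem particleEnergy_cellPoint_le {H : ℝ → ℝ} (hH : IsConvexDensity H) {N : ℕ} (hN : 2 ≤ N)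
    (hL : 0 < L) {n : Fin K → ℕ} (e : Fin N ≃ Σ k, Fin (n k)) :
    particleEnergy H (cellPoint c L n ∘ e) ≤ ∑ k, L * H ((n k + 1) / N / L) := by
  have h_gap : ∀ i j, j ≠ i → L / (n (e i).1 + 1) ≤
      |(cellPoint c L n ∘ e) i - (cellPoint c L n ∘ e) j| := fun i j hji =>
    div_le_abs_cellPoint_sub hL.le n (e.injective.ne hji.symm)
  have h_term : ∀ k, n k * (L / (n k + 1) * H (1 / (N * (L / (n k + 1))))) ≤
      L * H ((n k + 1) / N / L) := fun k => by
    have h_arg : 1 / (N * (L / (n k + 1))) = ((n k : ℝ) + 1) / N / L := by field_simp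
    have h_frac : (n k : ℝ) / (n k + 1) ≤ 1 := div_le_one_of_le₀ (by linarith) (by positivity)
    calc n k * (L / (n k + 1) * H (1 / (N * (L / (n k + 1)))))
        = n k / (n k + 1) * (L * H ((n k + 1) / N / L)) := by
          rw [h_arg]
          ring
      _ ≤ L * H ((n k + 1) / N / L) :=
        mul_le_of_le_one_left (mul_nonneg hL.le (hH.nonneg _ (by positivity))) h_frac
  calc particleEnergy H (cellPoint c L n ∘ e)
      ≤ ∑ i, L / (n (e i).1 + 1) * H (1 / (N * (L / (n (e i).1 + 1)))) :=
        particleEnergy_le hH hN (fun i => by positivity) h_gap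
    _ = ∑ a : Σ k, Fin (n k), L / (n a.1 + 1) * H (1 / (N * (L / (n a.1 + 1)))) :=
        e.sum_comp fun a => L / (n a.1 + 1) * H (1 / (N * (L / (n a.1 + 1))))
    _ = ∑ k, n k * (L / (n k + 1) * H (1 / (N * (L / (n k + 1))))) := by
        simp [Fintype.sum_sigma]
    _ ≤ ∑ k, L * H ((n k + 1) / N / L) := Finset.sum_le_sum fun k _ => h_term k

/-- An upper bound, as a function of `y`, for the distance from `y` to the points of the `k`-th
closed cell. -/
noncomputable def cellDist (c L : ℝ) (k : ℕ) (y : ℝ) : ℝ≥0∞ :=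
  edist y (c + L * k) + ENNReal.ofReal L

theorem edist_le_of_mem_closedCell {k : ℕ} {x : ℝ} (hx : x ∈ closedCell c L k) :
    edist x (c + L * k) ≤ ENNReal.ofReal L := by
  rw [edist_dist, Real.dist_eq, abs_of_nonneg (by linarith [hx.1])]
  exact ENNReal.ofReal_le_ofReal (by linarith [hx.2])

theorem edist_le_cellDist {k : ℕ} {x : ℝ} (hx : x ∈ closedCell c L k) (y : ℝ) :
    edist x y ≤ cellDist c L k y :=
  calc edist x y ≤ edist x (c + L * k) + edist (c + L * k) y := edist_triangle _ _ _
    _ ≤ ENNReal.ofReal L + edist (c + L * k) y := by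
      gcongr
      exact edist_le_of_mem_closedCell hx
    _ = cellDist c L k y := by rw [add_comm, edist_comm, cellDist]

theorem cellDist_le_edist_add {k : ℕ} {u : ℝ} (hu : u ∈ closedCell c L k) (y : ℝ) :
    cellDist c L k y ≤ edist y u + 2 * ENNReal.ofReal L :=
  calc cellDist c L k y ≤ edist y u + edist u (c + L * k) + ENNReal.ofReal L := by
        rw [cellDist]
        gcongr
        exact edist_triangle _ _ _
    _ ≤ edist y u + ENNReal.ofReal L + ENNReal.ofReal L := by
      gcongr
      exact edist_le_of_mem_closedCell hu
    _ = edist y u + 2 * ENNReal.ofReal L := by rw [two_mul, add_assoc]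

theorem wassersteinDist_rpow_cellPoint_le {p : ℝ} (hp : 0 < p) (hL : 0 ≤ L) {N : ℕ}
    {n : Fin K → ℕ} (e : Fin N ≃ Σ k, Fin (n k)) {ν : Fin K → Measure ℝ}
    [∀ k, SFinite (ν k)] (hν : ∀ k, ν k univ = n k / N)
    (hν_prob : IsProbabilityMeasure (∑ k, ν k)) :
    wassersteinDist p (empirical (cellPoint c L n ∘ e)) (∑ k, ν k) ^ p ≤
      ∑ k, ∫⁻ y, cellDist c L k y ^ p ∂ν k := by
  let σ : (Σ k, Fin (n k)) → Measure ℝ := fun a => (n a.1 : ℝ≥0∞)⁻¹ • ν a.1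
  have h_split : ∀ k, n k • (n k : ℝ≥0∞)⁻¹ • ν k = ν k := fun k => by
    rcases eq_or_ne (n k) 0 with h | h
    · simp [h, Measure.measure_univ_eq_zero.1 (show ν k univ = 0 by simp [hν, h])]
    · rw [← Nat.cast_smul_eq_nsmul ℝ≥0∞, smul_smul, ENNReal.mul_inv_cancel (by simpa) (by simp),
        one_smul]
  have h_sum : ∑ a, σ a = ∑ k, ν k := by
    simp [σ, Fintype.sum_sigma, h_split]
  have h_mass : ∀ a, σ a univ = (N : ℝ≥0∞)⁻¹ := fun a => by
    have h_pos : n a.1 ≠ 0 := a.2.pos.ne'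
    rw [Measure.smul_apply, hν, smul_eq_mul, div_eq_mul_inv,
      ENNReal.inv_mul_cancel_left (by simpa) (by simp)]
  have h_empirical : ∑ a, σ a univ • Measure.dirac (cellPoint c L n a) =
      empirical (cellPoint c L n ∘ e) := by
    simp only [h_mass, empirical, Finset.smul_sum, Function.comp_apply]
    exact (e.sum_comp fun a => (N : ℝ≥0∞)⁻¹ • Measure.dirac (cellPoint c L n a)).symm
  have h_sfinite : ∀ a, SFinite (σ a) := fun a => by
    simp only [σ]
    infer_instance
  calc wassersteinDist p (empirical (cellPoint c L n ∘ e)) (∑ k, ν k) ^ p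
      ≤ ∑ a, ∫⁻ y, edist (cellPoint c L n a) y ^ p ∂σ a := by
        rw [← h_empirical, ← h_sum]
        exact wassersteinDist_rpow_sum_dirac_le hp _ σ (h_sum ▸ hν_prob)
    _ ≤ ∑ a, ∫⁻ y, cellDist c L a.1 y ^ p ∂σ a := by
        gcongr with a _ y
        exact edist_le_cellDist (cellPoint_mem_closedCell hL n a) y
    _ = ∑ k, ∫⁻ y, cellDist c L k y ^ p ∂ν k := by
        rw [Fintype.sum_sigma]
        refine Finset.sum_congr rfl fun k _ => ?_
        simp_rw [σ]
        rw [← lintegral_finsetSum_measure, Finset.sum_const, Finset.card_fin, h_split]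

end Cells

theorem lintegral_piSingle {ι : Type*} [DecidableEq ι] {α : Type*}
    [MeasurableSpace α] (k₀ : ι) (g : ι → α → ℝ≥0∞) (μ : Measure α) (k : ι) :
    ∫⁻ y, g k y ∂(Pi.single (M := fun _ => Measure α) k₀ μ k) =
      Pi.single (M := fun _ => ℝ≥0∞) k₀ (∫⁻ y, g k₀ y ∂μ) k := by
  rcases eq_or_ne k k₀ with rfl | hk
  · simp only [Pi.single_eq_same]
  · simp [hk]

section Apportionment

variable {ι : Type*} [Fintype ι]

theorem sum_natFloor_mul_le {m : ι → ℝ} (hm : ∀ k, 0 ≤ m k) (hm1 : ∑ k, m k ≤ 1) (N : ℕ) :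
    ∑ j, ⌊m j * N⌋₊ ≤ N := by
  have h : ∑ j, (⌊m j * N⌋₊ : ℝ) ≤ N :=
    calc ∑ j, (⌊m j * N⌋₊ : ℝ) ≤ ∑ j, m j * N :=
          Finset.sum_le_sum fun j _ => Nat.floor_le (mul_nonneg (hm j) N.cast_nonneg)
      _ = (∑ j, m j) * N := by rw [Finset.sum_mul]
      _ ≤ N := mul_le_of_le_one_left N.cast_nonneg hm1
  exact_mod_cast h

variable [DecidableEq ι]

/-- Integer shares of `N` approximating the proportions `m`: every share is rounded down, and
`k₀` receives the rest. -/
noncomputable def roundedCount (m : ι → ℝ) (k₀ : ι) (N : ℕ) (k : ι) : ℕ :=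
  ⌊m k * N⌋₊ + Pi.single (M := fun _ => ℕ) k₀ (N - ∑ j, ⌊m j * N⌋₊) k

theorem sum_roundedCount {m : ι → ℝ} (hm : ∀ k, 0 ≤ m k) (hm1 : ∑ k, m k ≤ 1) (k₀ : ι) (N : ℕ) :
    ∑ k, roundedCount m k₀ N k = N := by
  simp only [roundedCount, Finset.sum_add_distrib, Finset.sum_pi_single', Finset.mem_univ, if_true]
  exact Nat.add_sub_of_le (sum_natFloor_mul_le hm hm1 N)

theorem roundedCount_div {m : ι → ℝ} (hm : ∀ k, 0 ≤ m k) (hm1 : ∑ k, m k ≤ 1) (k₀ : ι) {N : ℕ}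
    (hN : N ≠ 0) (k : ι) : (roundedCount m k₀ N k : ℝ) / N =
      (⌊m k * N⌋₊ : ℝ) / N +
        Pi.single (M := fun _ => ℝ) k₀ (1 - ∑ j, (⌊m j * N⌋₊ : ℝ) / N) k := by
  have hN' : (N : ℝ) ≠ 0 := by exact_mod_cast hN
  rcases eq_or_ne k k₀ with rfl | hk
  · simp only [roundedCount, Pi.single_eq_same]
    rw [Nat.cast_add, Nat.cast_sub (sum_natFloor_mul_le hm hm1 N), Nat.cast_sum, add_div, sub_div,
      div_self hN', Finset.sum_div]
  · simp [roundedCount, hk]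

theorem tendsto_natFloor_mul_div {m : ℝ} (hm : 0 ≤ m) :
    Tendsto (fun N : ℕ => (⌊m * N⌋₊ : ℝ) / N) atTop (𝓝 m) :=
  (tendsto_nat_floor_mul_div_atTop hm).comp tendsto_natCast_atTop_atTop

theorem tendsto_roundedCount_div {m : ι → ℝ} (hm : ∀ k, 0 ≤ m k) (hm1 : ∑ k, m k = 1) (k₀ k : ι) :
    Tendsto (fun N : ℕ => (roundedCount m k₀ N k : ℝ) / N) atTop (𝓝 (m k)) := by
  have h_rest : Tendsto (fun N : ℕ => 1 - ∑ j, (⌊m j * N⌋₊ : ℝ) / N) atTop (𝓝 0) := by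
    have h := (tendsto_finsetSum Finset.univ fun j _ => tendsto_natFloor_mul_div (hm j)).const_sub 1
    rwa [hm1, sub_self] at h
  have h_single : Tendsto (fun N : ℕ => Pi.single (M := fun _ => ℝ) k₀
      (1 - ∑ j, (⌊m j * N⌋₊ : ℝ) / N) k) atTop (𝓝 0) := by
    rcases eq_or_ne k k₀ with rfl | hk
    · simpa only [Pi.single_eq_same] using h_rest
    · simp [hk]
  rw [← add_zero (m k)]
  refine ((tendsto_natFloor_mul_div (hm k)).add h_single).congr' ?_
  filter_upwards [eventually_ne_atTop 0] with N hN
  rw [roundedCount_div hm hm1.le k₀ hN]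

/-- The fraction of a mass `m` that survives when it is rounded down to a multiple of `1 / N`.
It is `0` if `m = 0`. -/
noncomputable def keptFraction (m : ℝ) (N : ℕ) : ℝ :=
  (⌊m * N⌋₊ : ℝ) / N / m

theorem keptFraction_mul (m : ℝ) (N : ℕ) : keptFraction m N * m = (⌊m * N⌋₊ : ℝ) / N :=
  div_mul_cancel_of_imp fun h => by simp [h]

theorem keptFraction_nonneg {m : ℝ} (hm : 0 ≤ m) (N : ℕ) : 0 ≤ keptFraction m N := by
  unfold keptFraction
  positivity

theorem keptFraction_le_one {m : ℝ} (hm : 0 ≤ m) (N : ℕ) : keptFraction m N ≤ 1 := by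
  refine div_le_one_of_le₀ (div_le_of_le_mul₀ N.cast_nonneg hm ?_) hm
  exact Nat.floor_le (mul_nonneg hm N.cast_nonneg)

theorem tendsto_keptFraction {m : ℝ} (hm : 0 < m) :
    Tendsto (keptFraction m) atTop (𝓝 1) := by
  rw [← div_self hm.ne']
  exact (tendsto_natFloor_mul_div hm.le).div_const m

/-- The measures `τ k` after moving mass to the index `k₀` so that the masses of all of them become
the multiples `roundedCount _ k₀ N k / N` of `1 / N`. -/
noncomputable def roundedPiece (τ : ι → Measure ℝ) (k₀ : ι) (N : ℕ) (k : ι) : Measure ℝ :=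
  ENNReal.ofReal (keptFraction ((τ k).real univ) N) • τ k + Pi.single (M := fun _ => Measure ℝ) k₀
    (∑ j, ENNReal.ofReal (1 - keptFraction ((τ j).real univ) N) • τ j) k

theorem sum_roundedPiece (τ : ι → Measure ℝ) (k₀ : ι) (N : ℕ) :
    ∑ k, roundedPiece τ k₀ N k = ∑ k, τ k := by
  simp only [roundedPiece, Finset.sum_add_distrib, Finset.sum_pi_single', Finset.mem_univ, if_true]
  rw [← Finset.sum_add_distrib]
  refine Finset.sum_congr rfl fun k _ => ?_
  rw [← add_smul, ← ENNReal.ofReal_add (keptFraction_nonneg measureReal_nonneg N)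
    (sub_nonneg.2 (keptFraction_le_one measureReal_nonneg N)), add_sub_cancel, ENNReal.ofReal_one,
    one_smul]

instance isFiniteMeasure_roundedPiece (τ : ι → Measure ℝ) [∀ k, IsFiniteMeasure (τ k)] (k₀ : ι)
    (N : ℕ) (k : ι) : IsFiniteMeasure (roundedPiece τ k₀ N k) := by
  have h_le : roundedPiece τ k₀ N k ≤ ∑ k, roundedPiece τ k₀ N k :=
    Finset.single_le_sum (fun _ _ => Measure.zero_le _) (Finset.mem_univ k)
  rw [sum_roundedPiece] at h_le
  exact isFiniteMeasure_of_le _ h_le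

theorem roundedPiece_univ (τ : ι → Measure ℝ) [∀ k, IsFiniteMeasure (τ k)]
    (hτ : ∑ k, (τ k).real univ = 1) (k₀ : ι) {N : ℕ} (hN : N ≠ 0) (k : ι) :
    roundedPiece τ k₀ N k univ = roundedCount (fun j => (τ j).real univ) k₀ N k / N := by
  let m : ι → ℝ := fun j => (τ j).real univ
  have h_mass : ∀ j {c : ℝ}, 0 ≤ c → (ENNReal.ofReal c • τ j) univ = ENNReal.ofReal (c * m j) :=
    fun j c hc => by
      rw [Measure.smul_apply, smul_eq_mul, ENNReal.ofReal_mul hc, ofReal_measureReal]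
  have h_kept : (ENNReal.ofReal (keptFraction (m k) N) • τ k) univ =
      ENNReal.ofReal ((⌊m k * N⌋₊ : ℝ) / N) := by
    rw [h_mass k (keptFraction_nonneg measureReal_nonneg N), keptFraction_mul]
  have h_lost_nonneg : ∀ j, 0 ≤ 1 - keptFraction (m j) N := fun j =>
    sub_nonneg.2 (keptFraction_le_one measureReal_nonneg N)
  have h_term_nonneg : ∀ j, 0 ≤ (1 - keptFraction (m j) N) * m j := fun j =>
    mul_nonneg (h_lost_nonneg j) measureReal_nonneg
  have h_sum : ∑ j, (1 - keptFraction (m j) N) * m j = 1 - ∑ j, (⌊m j * N⌋₊ : ℝ) / N := by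
    simp only [sub_mul, one_mul, keptFraction_mul, Finset.sum_sub_distrib, m, hτ]
  have h_lost : ∑ j, (ENNReal.ofReal (1 - keptFraction (m j) N) • τ j) univ =
      ENNReal.ofReal (1 - ∑ j, (⌊m j * N⌋₊ : ℝ) / N) := by
    rw [← h_sum, ENNReal.ofReal_sum_of_nonneg fun j _ => h_term_nonneg j]
    exact Finset.sum_congr rfl fun j _ => h_mass j (h_lost_nonneg j)
  have h_sum_nonneg : 0 ≤ 1 - ∑ j, (⌊m j * N⌋₊ : ℝ) / N :=
    h_sum ▸ Finset.sum_nonneg fun j _ => h_term_nonneg j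
  have h_count : ENNReal.ofReal ((roundedCount m k₀ N k : ℝ) / N) = roundedCount m k₀ N k / N := by
    rw [ENNReal.ofReal_div_of_pos (by positivity), ENNReal.ofReal_natCast, ENNReal.ofReal_natCast]
  rw [← h_count, roundedCount_div (fun j => measureReal_nonneg) hτ.le k₀ hN]
  rcases eq_or_ne k k₀ with rfl | hk
  · simp only [roundedPiece, Pi.single_eq_same, Measure.add_apply, Measure.finsetSum_apply]
    rw [ENNReal.ofReal_add (by positivity) h_sum_nonneg, h_kept, h_lost]
  · simpa [roundedPiece, hk] using h_kept

theorem sum_lintegral_roundedPiece (τ : ι → Measure ℝ) (k₀ : ι) (N : ℕ) (g : ι → ℝ → ℝ≥0∞) :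
    ∑ k, ∫⁻ y, g k y ∂roundedPiece τ k₀ N k =
      ∑ k, (ENNReal.ofReal (keptFraction ((τ k).real univ) N) * ∫⁻ y, g k y ∂τ k +
        ENNReal.ofReal (1 - keptFraction ((τ k).real univ) N) * ∫⁻ y, g k₀ y ∂τ k) := by
  simp only [roundedPiece, lintegral_add_measure, lintegral_smul_measure, lintegral_piSingle,
    lintegral_finsetSum_measure, smul_eq_mul, Finset.sum_add_distrib, Finset.sum_pi_single',
    Finset.mem_univ, if_true]

theorem eventually_sum_lintegral_roundedPiece_le (τ : ι → Measure ℝ) [∀ k, IsFiniteMeasure (τ k)]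
    (k₀ : ι) {g : ι → ℝ → ℝ≥0∞} (hg : ∀ k, ∫⁻ y, g k₀ y ∂τ k ≠ ∞) {ε : ℝ≥0∞} (hε : ε ≠ 0) :
    ∀ᶠ N in atTop, ∑ k, ∫⁻ y, g k y ∂roundedPiece τ k₀ N k ≤ ∑ k, ∫⁻ y, g k y ∂τ k + ε := by
  have h_zero : Tendsto (fun N => ∑ k, ENNReal.ofReal (1 - keptFraction ((τ k).real univ) N) *
      ∫⁻ y, g k₀ y ∂τ k) atTop (𝓝 0) := by
    rw [← Finset.sum_const_zero (s := (Finset.univ : Finset ι))]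
    refine tendsto_finsetSum _ fun k _ => ?_
    rcases eq_or_ne (τ k) 0 with h | h
    · simp [h]
    · have h_mass : 0 < (τ k).real univ :=
        have : NeZero (τ k) := ⟨h⟩
        measureReal_univ_pos
      have h_kept := ENNReal.tendsto_ofReal ((tendsto_keptFraction h_mass).const_sub 1)
      simpa using ENNReal.Tendsto.mul_const h_kept (.inr (hg k))
  filter_upwards [h_zero.eventually_le_const (pos_iff_ne_zero.2 hε)] with N hN
  rw [sum_lintegral_roundedPiece, Finset.sum_add_distrib]
  gcongr with k
  exact mul_le_of_le_one_left' (ENNReal.ofReal_le_one.2 (keptFraction_le_one measureReal_nonneg N))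

end Apportionment

theorem closedCell_subset_Icc {c L : ℝ} (hL : 0 ≤ L) {k K : ℕ} (hk : k < K) :
    closedCell c L k ⊆ Icc c (c + L * K) := by
  have h_left : 0 ≤ L * (k : ℝ) := by positivity
  have h_right : L * ((k : ℝ) + 1) ≤ L * K := mul_le_mul_of_nonneg_left (by exact_mod_cast hk) hL
  exact Icc_subset_Icc (by linarith) (by linarith)

theorem Icc_subset_iUnion_closedCell {c L : ℝ} (hL : 0 < L) {K : ℕ} (hK : 0 < K) :
    Icc c (c + L * K) ⊆ ⋃ k : Fin K, closedCell c L k := by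
  intro y hy
  have h_pos : 0 ≤ (y - c) / L := div_nonneg (by linarith [hy.1]) hL.le
  have h_eq : L * ((y - c) / L) = y - c := mul_div_cancel₀ _ hL.ne'
  let k := min ⌊(y - c) / L⌋₊ (K - 1)
  have hk : k < K := (min_le_right _ _).trans_lt (Nat.pred_lt hK.ne')
  have h_le : (k : ℝ) ≤ (y - c) / L := (Nat.cast_le.2 (min_le_left _ _)).trans (Nat.floor_le h_pos)
  have h_ge : (y - c) / L ≤ k + 1 := by
    rcases min_choice ⌊(y - c) / L⌋₊ (K - 1) with h | h
    · simp only [k, h]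
      exact (Nat.lt_floor_add_one _).le
    · have h_last : (k : ℝ) + 1 = K := by
        exact_mod_cast (show k + 1 = K by omega)
      rw [h_last, div_le_iff₀ hL]
      linarith [hy.2]
  refine mem_iUnion.2 ⟨⟨k, hk⟩, ?_, ?_⟩
  · linarith [mul_le_mul_of_nonneg_left h_le hL.le]
  · linarith [mul_le_mul_of_nonneg_left h_ge hL.le]

theorem eventually_exists_atomic_le {p : ℝ} (hp : 0 < p) {H : ℝ → ℝ} (hH : IsConvexDensity H)
    {Ω : Set ℝ} {c L : ℝ} (hL : 0 < L) {K : ℕ} (hΩ : Icc c (c + L * K) ⊆ Ω)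
    {τ : Fin K → Measure ℝ} [hτ : IsProbabilityMeasure (∑ k, τ k)] {k₀ : Fin K}
    (hτ_fin : ∀ k, ∫⁻ y, cellDist c L k₀ y ^ p ∂τ k ≠ ∞) {ε : ℝ≥0∞} (hε : ε ≠ 0) :
    ∀ᶠ N in atTop, ∃ μ ∈ Atomic N Ω,
      wassersteinDist p μ (∑ k, τ k) ^ p ≤ ∑ k, ∫⁻ y, cellDist c L k y ^ p ∂τ k + ε ∧
      discreteEnergy H N μ ≤ ENNReal.ofReal (∑ k, L * H ((τ k).real univ / L)) + ε := by
  have h_fin : ∀ k, IsFiniteMeasure (τ k) := fun k =>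
    isFiniteMeasure_of_le _
      (Finset.single_le_sum (fun _ _ => Measure.zero_le _) (Finset.mem_univ k))
  let m : Fin K → ℝ := fun k => (τ k).real univ
  have hm_nonneg : ∀ k, 0 ≤ m k := fun k => measureReal_nonneg
  have hm : ∑ k, m k = 1 := by
    simp only [m, measureReal_def]
    rw [← ENNReal.toReal_sum fun k _ => measure_ne_top _ _, ← Measure.finsetSum_apply, measure_univ,
      ENNReal.toReal_one]
  have h_energy : Tendsto (fun N : ℕ => ENNReal.ofReal
      (∑ k, L * H ((roundedCount m k₀ N k + 1) / N / L))) atTop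
      (𝓝 (ENNReal.ofReal (∑ k, L * H (m k / L)))) := by
    refine ENNReal.tendsto_ofReal (tendsto_finsetSum _ fun k _ => Tendsto.const_mul L ?_)
    refine hH.tendsto_comp (fun N => by positivity) (by positivity) (Tendsto.div_const ?_ L)
    simpa [add_div] using (tendsto_roundedCount_div hm_nonneg hm k₀ k).add
      tendsto_one_div_atTop_nhds_zero_nat
  filter_upwards [eventually_ge_atTop 2,
    eventually_sum_lintegral_roundedPiece_le τ k₀ (g := fun k y => cellDist c L k y ^ p) hτ_fin hε,
    h_energy.eventually_lt_const (ENNReal.lt_add_right ENNReal.ofReal_ne_top hε)]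
    with N hN h_cost h_energy_le
  have h_card : Fintype.card (Σ k, Fin (roundedCount m k₀ N k)) = N := by
    simp [sum_roundedCount hm_nonneg hm.le]
  obtain ⟨e, he⟩ := exists_equiv_strictMono_comp h_card (cellPoint_injective (c := c) hL _)
  have h_mem : ∀ i, (cellPoint c L (roundedCount m k₀ N) ∘ e) i ∈ Ω := fun i =>
    hΩ (closedCell_subset_Icc hL.le (Fin.isLt _) (cellPoint_mem_closedCell hL.le _ (e i)))
  refine ⟨_, ⟨_, he, h_mem, rfl⟩, ?_, ?_⟩
  · rw [← sum_roundedPiece τ k₀ N] at hτ ⊢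
    exact (wassersteinDist_rpow_cellPoint_le hp hL.le e
      (roundedPiece_univ τ hm k₀ (by omega)) hτ).trans h_cost
  · rw [discreteEnergy_empirical H he]
    exact (ENNReal.ofReal_le_ofReal (particleEnergy_cellPoint_le hH hN hL e)).trans h_energy_le.le

section GridPieces

variable {p : ℝ} {H : ℝ → ℝ} {Ω : Set ℝ} {ρ : Measure ℝ} {c L : ℝ} {K : ℕ}

theorem iUnion_closedCell (hL : 0 < L) (hK : 0 < K) :
    ⋃ k : Fin K, closedCell c L k = Icc c (c + L * K) :=
  (iUnion_subset fun k => closedCell_subset_Icc hL.le k.isLt).antisymm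
    (Icc_subset_iUnion_closedCell hL hK)

theorem volume_real_closedCell (hL : 0 ≤ L) (k : ℕ) : volume.real (closedCell c L k) = L := by
  rw [closedCell, Real.volume_real_Icc_of_le (by linarith)]
  ring

theorem aedisjoint_closedCell (hL : 0 ≤ L) {i j : ℕ} (hij : i < j) :
    AEDisjoint volume (closedCell c L i) (closedCell c L j) := by
  have h_step : L * ((i : ℝ) + 1) ≤ L * j := mul_le_mul_of_nonneg_left (by exact_mod_cast hij) hL
  have h_subset : closedCell c L i ∩ closedCell c L j ⊆ {c + L * (i + 1)} := fun y hy =>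
    le_antisymm hy.1.2 (by linarith [hy.2.1])
  exact measure_mono_null h_subset Real.volume_singleton

theorem volume_restrict_Icc_eq_sum (hL : 0 < L) (hK : 0 < K) :
    volume.restrict (Icc c (c + L * K)) = ∑ k : Fin K, volume.restrict (closedCell c L k) := by
  have h_disj : Pairwise (Function.onFun (AEDisjoint volume) fun k : Fin K => closedCell c L k) :=
    fun i j hij => (lt_or_gt_of_ne hij).elim (aedisjoint_closedCell hL.le)
      fun h => (aedisjoint_closedCell hL.le h).symm
  rw [← iUnion_closedCell hL hK, Measure.restrict_iUnion_ae h_disj fun k =>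
    measurableSet_Icc.nullMeasurableSet, Measure.sum_fintype]

theorem restrict_Icc_eq_sum_disjointed (ρ : Measure ℝ) (hL : 0 < L) (hK : 0 < K) :
    ρ.restrict (Icc c (c + L * K)) =
      ∑ k, ρ.restrict (disjointed (fun j : Fin K => closedCell c L j) k) := by
  have h_meas : ∀ k, MeasurableSet (disjointed (fun j : Fin K => closedCell c L j) k) := fun k =>
    disjointedRec (fun _ _ h => h.diff measurableSet_Icc) measurableSet_Icc
  rw [← iUnion_closedCell hL hK, ← iUnion_disjointed,
    Measure.restrict_iUnion (disjoint_disjointed _) h_meas, Measure.sum_fintype]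

theorem ofReal_cellEnergy_le (hH : IsConvexDensity H) [IsFiniteMeasure ρ] (hρ : ρ ≪ volume)
    {s : Set ℝ} (hs : volume s ≠ ∞) :
    ENNReal.ofReal (cellEnergy H ρ s) ≤
      ∫⁻ x in s, ENNReal.ofReal (H (ρ.rnDeriv volume x).toReal) := by
  let f : ℝ → ℝ := fun x => (ρ.rnDeriv volume x).toReal
  have hf_nonneg : ∀ x, 0 ≤ f x := fun x => ENNReal.toReal_nonneg
  have hHf_nonneg : ∀ x, 0 ≤ H (f x) := fun x => hH.nonneg _ (hf_nonneg x)
  rcases eq_or_ne (∫⁻ x in s, ENNReal.ofReal (H (f x))) ∞ with h_top | h_top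
  · exact h_top ▸ le_top
  rcases eq_or_ne (volume s) 0 with hs0 | hs0
  · simp [cellEnergy, measureReal_def, hs0]
  have hs_pos : 0 < volume.real s := ENNReal.toReal_pos hs0 hs
  have h_meas : Measurable fun x => H (f x) := by
    have h_cont : Continuous fun x => H (max x 0) :=
      hH.continuousOn.comp_continuous (by fun_prop) fun x => le_max_right x 0
    have := h_cont.measurable.comp (Measure.measurable_rnDeriv ρ volume).ennreal_toReal
    simpa [Function.comp_def] using this
  have h_int : IntegrableOn (fun x => H (f x)) s := by
    refine ⟨h_meas.aestronglyMeasurable, ?_⟩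
    rw [hasFiniteIntegral_iff_ofReal (.of_forall hHf_nonneg)]
    exact h_top.lt_top
  have h_jensen := hH.convexOn.map_set_average_le hH.continuousOn isClosed_Ici hs0 hs
    (.of_forall hf_nonneg) Measure.integrable_toReal_rnDeriv.integrableOn h_int
  rw [setAverage_eq, setAverage_eq, Measure.setIntegral_toReal_rnDeriv hρ, smul_eq_mul,
    smul_eq_mul, inv_mul_eq_div, inv_mul_eq_div, le_div_iff₀' hs_pos] at h_jensen
  exact (ENNReal.ofReal_le_ofReal h_jensen).trans_eq
    (ofReal_integral_eq_lintegral_ofReal h_int (.of_forall hHf_nonneg))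

theorem ofReal_sum_cellEnergy_le_energy (hH : IsConvexDensity H) [IsFiniteMeasure ρ]
    (hL : 0 < L) (hK : 0 < K) (hΩ : Icc c (c + L * K) ⊆ Ω) :
    ENNReal.ofReal (∑ k : Fin K, cellEnergy H ρ (closedCell c L k)) ≤ energy H Ω ρ := by
  by_cases hρ : ρ ≪ volume
  case neg =>
    rw [energy, if_neg hρ]
    exact le_top
  rw [ENNReal.ofReal_sum_of_nonneg fun k _ => hH.cellEnergy_nonneg ρ _, energy, if_pos hρ]
  calc ∑ k : Fin K, ENNReal.ofReal (cellEnergy H ρ (closedCell c L k))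
      ≤ ∑ k : Fin K, ∫⁻ x in closedCell c L k, ENNReal.ofReal (H (ρ.rnDeriv volume x).toReal) :=
        Finset.sum_le_sum fun k _ => ofReal_cellEnergy_le hH hρ isCompact_Icc.measure_ne_top
    _ = ∫⁻ x in Icc c (c + L * K), ENNReal.ofReal (H (ρ.rnDeriv volume x).toReal) := by
        rw [volume_restrict_Icc_eq_sum hL hK, lintegral_finsetSum_measure]
    _ ≤ ∫⁻ x in Ω, ENNReal.ofReal (H (ρ.rnDeriv volume x).toReal) := lintegral_mono_set hΩ

/-- The part of `ρ` carried by the `k`-th closed cell, to which the mass of `ρ` outside all cells is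
added if `k = k₀`. As `ρ` may charge the common endpoints of the cells, each endpoint is counted in
the first cell that contains it. -/
noncomputable def gridPiece (ρ : Measure ℝ) (c L : ℝ) (k₀ k : Fin K) : Measure ℝ :=
  ρ.restrict (disjointed (fun j : Fin K => closedCell c L j) k) +
    Pi.single (M := fun _ => Measure ℝ) k₀ (ρ.restrict (Icc c (c + L * K))ᶜ) k

theorem sum_gridPiece (ρ : Measure ℝ) (hL : 0 < L) (k₀ : Fin K) :
    ∑ k, gridPiece ρ c L k₀ k = ρ := by
  simp only [gridPiece, Finset.sum_add_distrib, Finset.sum_pi_single', Finset.mem_univ, if_true]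
  rw [← restrict_Icc_eq_sum_disjointed ρ hL k₀.pos,
    Measure.restrict_add_restrict_compl measurableSet_Icc]

theorem cellDist_le_of_mem {k : ℕ} {y : ℝ} (hy : y ∈ closedCell c L k) :
    cellDist c L k y ≤ 2 * ENNReal.ofReal L := by
  rw [cellDist, two_mul]
  gcongr
  exact edist_le_of_mem_closedCell hy

theorem sum_lintegral_gridPiece_le [IsProbabilityMeasure ρ] (hp : 0 ≤ p) (hL : 0 < L)
    {k₀ : Fin K} {u : ℝ} (hu : u ∈ closedCell c L k₀) :
    ∑ k, ∫⁻ y, cellDist c L k y ^ p ∂gridPiece ρ c L k₀ k ≤ (2 * ENNReal.ofReal L) ^ p +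
      ∫⁻ y in (Icc c (c + L * K))ᶜ, (edist y u + 2 * ENNReal.ofReal L) ^ p ∂ρ := by
  let cell : Fin K → Set ℝ := disjointed fun j : Fin K => closedCell c L j
  have h_inside : ∑ k, ∫⁻ y in cell k, cellDist c L k y ^ p ∂ρ ≤ (2 * ENNReal.ofReal L) ^ p :=
    calc ∑ k, ∫⁻ y in cell k, cellDist c L k y ^ p ∂ρ
        ≤ ∑ k, ∫⁻ _ in cell k, (2 * ENNReal.ofReal L) ^ p ∂ρ :=
          Finset.sum_le_sum fun k _ => setLIntegral_mono measurable_const fun y hy =>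
            ENNReal.rpow_le_rpow (cellDist_le_of_mem (disjointed_subset _ k hy)) hp
      _ = ∫⁻ _ in Icc c (c + L * K), (2 * ENNReal.ofReal L) ^ p ∂ρ := by
          rw [restrict_Icc_eq_sum_disjointed ρ hL k₀.pos, lintegral_finsetSum_measure]
      _ ≤ ∫⁻ _, (2 * ENNReal.ofReal L) ^ p ∂ρ := setLIntegral_le_lintegral _ _
      _ = (2 * ENNReal.ofReal L) ^ p := by rw [lintegral_const, measure_univ, mul_one]
  simp only [gridPiece, lintegral_add_measure,
    lintegral_piSingle k₀ fun k : Fin K => fun y => cellDist c L k y ^ p, Finset.sum_add_distrib,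
    Finset.sum_pi_single', Finset.mem_univ, if_true]
  gcongr with y
  exact cellDist_le_edist_add hu y

theorem real_gridPiece_le (ρ : Measure ℝ) [IsFiniteMeasure ρ] (k₀ k : Fin K) :
    (gridPiece ρ c L k₀ k).real univ ≤ ρ.real (closedCell c L k) +
      Pi.single (M := fun _ => ℝ) k₀ (ρ.real (Icc c (c + L * K))ᶜ) k := by
  have h_le : ρ.real (disjointed (fun j : Fin K => closedCell c L j) k) ≤
      ρ.real (closedCell c L k) := measureReal_mono (disjointed_subset _ k)
  rcases eq_or_ne k k₀ with rfl | hk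
  · rw [gridPiece, Pi.single_eq_same, Pi.single_eq_same, measureReal_add_apply,
      measureReal_restrict_apply_univ, measureReal_restrict_apply_univ]
    gcongr
  · simpa [gridPiece, hk] using h_le

theorem sum_mul_map_gridPiece_le (hH : IsConvexDensity H) [IsProbabilityMeasure ρ] (hL : 0 < L)
    (k₀ : Fin K) (h_out : ρ.real (Icc c (c + L * K))ᶜ ≤ L) :
    ∑ k, L * H ((gridPiece ρ c L k₀ k).real univ / L) ≤
      ∑ k : Fin K, cellEnergy H ρ (closedCell c L k) +
        ρ.real (Icc c (c + L * K))ᶜ * H (1 / L + 1) := by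
  let d := ρ.real (Icc c (c + L * K))ᶜ
  have h_mono : ∀ {x y : ℝ}, 0 ≤ x → x ≤ y → H x ≤ H y := fun hx hxy =>
    hH.monotoneOn hx (hx.trans hxy) hxy
  have h_cell : ∀ k : Fin K, L * H ((gridPiece ρ c L k₀ k).real univ / L) ≤
      cellEnergy H ρ (closedCell c L k) +
        Pi.single (M := fun _ => ℝ) k₀ (d * H (1 / L + 1)) k := fun k => by
    rw [cellEnergy, volume_real_closedCell hL.le]
    let s := ρ.real (closedCell c L k)
    have h_mass := div_le_div_of_nonneg_right (real_gridPiece_le (c := c) (L := L) ρ k₀ k) hL.le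
    have h_le := mul_le_mul_of_nonneg_left (h_mono (by positivity) h_mass) hL.le
    refine h_le.trans ?_
    rcases eq_or_ne k k₀ with rfl | hk
    · simp only [Pi.single_eq_same, add_div]
      calc L * H (s / L + d / L) ≤ L * (H (s / L) + d / L * H (s / L + 1)) := by
            gcongr
            exact hH.map_add_le (by positivity) (by positivity) (div_le_one_of_le₀ h_out hL.le)
        _ = L * H (s / L) + d * H (s / L + 1) := by
            field_simp
        _ ≤ L * H (s / L) + d * H (1 / L + 1) := by
            gcongr
            exact h_mono (by positivity) (by gcongr; exact measureReal_le_one)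
    · simp [hk]
  refine (Finset.sum_le_sum fun k _ => h_cell k).trans_eq ?_
  simp only [Finset.sum_add_distrib, Finset.sum_pi_single', Finset.mem_univ, if_true, d]

theorem eventually_exists_atomic_grid (hp : 0 < p) (hH : IsConvexDensity H)
    [IsProbabilityMeasure ρ] (hL : 0 < L) (hΩ : Icc c (c + L * K) ⊆ Ω) {u : ℝ}
    (hu : u ∈ Icc c (c + L * K)) (hK : 0 < K)
    (h_moment : ∫⁻ y, (edist y u + 2 * ENNReal.ofReal L) ^ p ∂ρ ≠ ∞)
    (h_out : ρ.real (Icc c (c + L * K))ᶜ ≤ L) {ε : ℝ≥0∞} (hε : ε ≠ 0) :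
    ∀ᶠ N in atTop, ∃ μ ∈ Atomic N Ω,
      wassersteinDist p μ ρ ^ p ≤ (2 * ENNReal.ofReal L) ^ p +
        ∫⁻ y in (Icc c (c + L * K))ᶜ, (edist y u + 2 * ENNReal.ofReal L) ^ p ∂ρ + ε ∧
      discreteEnergy H N μ ≤ energy H Ω ρ +
        ENNReal.ofReal (ρ.real (Icc c (c + L * K))ᶜ * H (1 / L + 1)) + ε := by
  obtain ⟨k₀, hk₀⟩ := mem_iUnion.1 (Icc_subset_iUnion_closedCell hL hK hu)
  have h_sum := sum_gridPiece (c := c) ρ hL k₀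
  have : IsProbabilityMeasure (∑ k, gridPiece ρ c L k₀ k) := by rwa [h_sum]
  have h_piece_le : ∀ k, gridPiece ρ c L k₀ k ≤ ρ := fun k => by
    nth_rewrite 2 [← h_sum]
    exact Finset.single_le_sum (fun _ _ => Measure.zero_le _) (Finset.mem_univ k)
  have h_fin : ∀ k, ∫⁻ y, cellDist c L k₀ y ^ p ∂gridPiece ρ c L k₀ k ≠ ∞ := fun k =>
    ne_top_of_le_ne_top h_moment (lintegral_mono' (h_piece_le k) fun y =>
      ENNReal.rpow_le_rpow (cellDist_le_edist_add hk₀ y) hp.le)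
  filter_upwards [eventually_exists_atomic_le hp hH hL hΩ h_fin hε] with N ⟨μ, hμ, hW, hE⟩
  rw [h_sum] at hW
  refine ⟨μ, hμ, hW.trans ?_, hE.trans ?_⟩
  · gcongr
    exact sum_lintegral_gridPiece_le hp.le hL hk₀
  · gcongr
    refine (ENNReal.ofReal_le_ofReal (sum_mul_map_gridPiece_le hH hL k₀ h_out)).trans ?_
    refine ENNReal.ofReal_add_le.trans ?_
    gcongr
    exact ofReal_sum_cellEnergy_le_energy hH hL hK hΩ

end GridPieces

theorem exists_mesh {η ℓ : ℝ} (hη : 0 < η) (hηℓ : η ≤ ℓ) :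
    ∃ (K : ℕ) (L : ℝ), 0 < K ∧ L * K = ℓ ∧ η / 2 ≤ L ∧ L ≤ η := by
  have hℓ : 0 < ℓ := hη.trans_le hηℓ
  have hK : 0 < ⌈ℓ / η⌉₊ := Nat.ceil_pos.2 (by positivity)
  have hK' : (0 : ℝ) < ⌈ℓ / η⌉₊ := by exact_mod_cast hK
  have h_lt : (⌈ℓ / η⌉₊ : ℝ) < 2 * (ℓ / η) := by
    linarith [Nat.ceil_lt_add_one (div_nonneg hℓ.le hη.le), (one_le_div hη).2 hηℓ]
  refine ⟨⌈ℓ / η⌉₊, ℓ / ⌈ℓ / η⌉₊, hK, div_mul_cancel₀ _ hK'.ne', ?_, ?_⟩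
  · rw [le_div_iff₀ hK']
    calc η / 2 * ⌈ℓ / η⌉₊ ≤ η / 2 * (2 * (ℓ / η)) := by gcongr
      _ = ℓ := by field_simp
  · rw [div_le_iff₀ hK', ← div_le_iff₀' hη]
    exact Nat.le_ceil _

theorem exists_Icc_subset_measure_compl_lt {Ω : Set ℝ} (hΩ : Ω.OrdConnected) {ρ : Measure ℝ}
    [IsFiniteMeasure ρ] (hρΩ : ρ Ωᶜ = 0) {x₀ x₁ : ℝ} (hx₀ : x₀ ∈ Ω) (hx₁ : x₁ ∈ Ω) {δ : ℝ≥0∞}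
    (hδ : δ ≠ 0) : ∃ a b, a ≤ x₀ ∧ x₁ ≤ b ∧ Icc a b ⊆ Ω ∧ ρ (Icc a b)ᶜ < δ := by
  obtain ⟨S, hSΩ, hS, hρS⟩ :=
    hΩ.measurableSet.exists_isCompact_sdiff_lt (measure_ne_top ρ Ω) hδ
  let T := insert x₀ (insert x₁ S)
  have hT : IsCompact T := (hS.insert x₁).insert x₀
  have hTΩ : T ⊆ Ω := insert_subset hx₀ (insert_subset hx₁ hSΩ)
  have hT_ne : T.Nonempty := insert_nonempty _ _
  have hT_sub : T ⊆ Icc (sInf T) (sSup T) := subset_Icc_csInf_csSup hT.bddBelow hT.bddAbove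
  refine ⟨sInf T, sSup T, (hT_sub (mem_insert _ _)).1,
    (hT_sub (mem_insert_of_mem _ (mem_insert _ _))).2,
    hΩ.out (hTΩ (hT.sInf_mem hT_ne)) (hTΩ (hT.sSup_mem hT_ne)), ?_⟩
  have h_cover : (Icc (sInf T) (sSup T))ᶜ ⊆ Ω \ S ∪ Ωᶜ := fun y hy => by
    by_cases hyΩ : y ∈ Ω
    · exact .inl ⟨hyΩ, fun hyS => hy (hT_sub (.inr (.inr hyS)))⟩
    · exact .inr hyΩ
  calc ρ (Icc (sInf T) (sSup T))ᶜ ≤ ρ (Ω \ S) + ρ Ωᶜ :=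
        (measure_mono h_cover).trans (measure_union_le _ _)
    _ < δ := by rwa [hρΩ, add_zero]

theorem lintegral_edist_add_rpow_ne_top {p : ℝ} (hp : 0 ≤ p) {ρ : Measure ℝ} [IsFiniteMeasure ρ]
    (hρ : ∫⁻ x, ‖x‖ₑ ^ p ∂ρ ≠ ∞) (u : ℝ) {C : ℝ≥0∞} (hC : C ≠ ∞) :
    ∫⁻ y, (edist y u + C) ^ p ∂ρ ≠ ∞ := by
  have h_le : ∀ y, (edist y u + C) ^ p ≤ 2 ^ p * (‖y‖ₑ ^ p + (‖u‖ₑ + C) ^ p) := fun y =>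
    calc (edist y u + C) ^ p ≤ (‖y‖ₑ + (‖u‖ₑ + C)) ^ p := by
          rw [← add_assoc]
          gcongr
          rw [edist_eq_enorm_sub]
          exact enorm_sub_le
      _ ≤ 2 ^ p * (‖y‖ₑ ^ p + (‖u‖ₑ + C) ^ p) :=
          ENNReal.add_rpow_le_two_rpow_mul_rpow_add_rpow _ _ hp
  refine ne_top_of_le_ne_top ?_ (lintegral_mono h_le)
  rw [lintegral_const_mul' _ _ (by finiteness), lintegral_add_right _ measurable_const,
    lintegral_const]
  finiteness

theorem exists_mesh_rpow_le {p : ℝ} (hp : 0 < p) {ε : ℝ≥0∞} (hε : ε ≠ 0) {ℓ : ℝ} (hℓ : 0 < ℓ) :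
    ∃ η, 0 < η ∧ η ≤ ℓ ∧ (2 * ENNReal.ofReal η) ^ p ≤ ε := by
  have h_cont : Continuous fun η : ℝ => (2 * ENNReal.ofReal η) ^ p :=
    ENNReal.continuous_rpow_const.comp
      ((ENNReal.continuous_const_mul ENNReal.ofNat_ne_top).comp ENNReal.continuous_ofReal)
  have h_lim : Tendsto (fun η : ℝ => (2 * ENNReal.ofReal η) ^ p) (𝓝[>] 0) (𝓝 0) := by
    simpa [hp] using (h_cont.tendsto 0).mono_left nhdsWithin_le_nhds
  obtain ⟨η, h_le, hη⟩ := ((h_lim.eventually_le_const (pos_iff_ne_zero.2 hε)).and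
    (Ioc_mem_nhdsGT hℓ)).exists
  exact ⟨η, hη.1, hη.2, h_le⟩

theorem ofReal_real_mul_le {ρ : Measure ℝ} [IsFiniteMeasure ρ] {s : Set ℝ} {M : ℝ} {ε : ℝ≥0∞}
    (hs : ρ s ≤ ε / ENNReal.ofReal M) : ENNReal.ofReal (ρ.real s * M) ≤ ε := by
  rw [ENNReal.ofReal_mul measureReal_nonneg, ofReal_measureReal]
  exact ENNReal.mul_le_of_le_div hs

theorem exists_grid {p : ℝ} (hp : 0 < p) {H : ℝ → ℝ} (hH : IsConvexDensity H) {Ω : Set ℝ}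
    (hΩ : Ω.OrdConnected) {ρ : Measure ℝ} (hρ : ρ ∈ ProbP p Ω) {x₀ x₁ : ℝ} (hx₀ : x₀ ∈ Ω)
    (hx₁ : x₁ ∈ Ω) (hx : x₀ < x₁) {ε : ℝ≥0∞} (hε : ε ≠ 0) :
    ∃ (c L : ℝ) (K : ℕ), 0 < L ∧ 0 < K ∧ Icc c (c + L * K) ⊆ Ω ∧ x₀ ∈ Icc c (c + L * K) ∧
      ρ.real (Icc c (c + L * K))ᶜ ≤ L ∧ (2 * ENNReal.ofReal L) ^ p ≤ ε ∧
      ∫⁻ y in (Icc c (c + L * K))ᶜ, (edist y x₀ + 2 * ENNReal.ofReal L) ^ p ∂ρ ≤ ε ∧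
      ENNReal.ofReal (ρ.real (Icc c (c + L * K))ᶜ * H (1 / L + 1)) ≤ ε := by
  obtain ⟨hρ_prob, hρΩ, hρ_moment⟩ := hρ
  obtain ⟨η, hη, hη_le, hη_cost⟩ := exists_mesh_rpow_le hp hε (sub_pos.2 hx)
  have h_moment : ∫⁻ y, (edist y x₀ + 2 * ENNReal.ofReal η) ^ p ∂ρ ≠ ∞ :=
    lintegral_edist_add_rpow_ne_top hp.le hρ_moment.ne x₀ (by finiteness)
  obtain ⟨δ, hδ, h_tail⟩ := exists_pos_setLIntegral_lt_of_measure_lt h_moment hε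
  -- The mesh is only known up to a factor `2` before the interval is chosen.
  let θ := min δ (min (ENNReal.ofReal (η / 2)) (ε / ENNReal.ofReal (H (2 / η + 1))))
  have hθ : 0 < θ := lt_min hδ (lt_min (ENNReal.ofReal_pos.2 (half_pos hη))
    (ENNReal.div_pos hε ENNReal.ofReal_ne_top))
  obtain ⟨a, b, hax, hxb, habΩ, h_out⟩ :=
    exists_Icc_subset_measure_compl_lt hΩ hρΩ hx₀ hx₁ hθ.ne'
  obtain ⟨h_out_tail, h_out_mesh, h_out_energy⟩ := by simpa only [θ, lt_min_iff] using h_out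
  obtain ⟨K, L, hK, hLK, hηL, hLη⟩ := exists_mesh hη (show η ≤ b - a by linarith)
  obtain rfl : b = a + L * K := by linarith
  have hL : 0 < L := by linarith
  have h_mesh : 1 / L ≤ 2 / η := by
    rw [div_le_div_iff₀ hL hη]
    linarith
  have h_mono : H (1 / L + 1) ≤ H (2 / η + 1) :=
    hH.monotoneOn (mem_Ici.2 (by positivity)) (mem_Ici.2 (by positivity)) (by linarith)
  refine ⟨a, L, K, hL, hK, habΩ, ⟨hax, by linarith⟩, ?_, hη_cost.trans' (by gcongr), ?_, ?_⟩
  · exact (ENNReal.toReal_le_of_le_ofReal (half_pos hη).le h_out_mesh.le).trans hηL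
  · exact (lintegral_mono fun y => by gcongr).trans (h_tail _ h_out_tail).le
  · exact (ENNReal.ofReal_le_ofReal (by gcongr)).trans (ofReal_real_mul_le h_out_energy.le)

theorem eventually_exists_atomic_near {p : ℝ} (hp : 0 < p) {H : ℝ → ℝ} (hH : IsConvexDensity H)
    {Ω : Set ℝ} (hΩ : Ω.OrdConnected) (hΩ' : Ω.Nontrivial) {ρ : Measure ℝ} (hρ : ρ ∈ ProbP p Ω)
    {ε : ℝ≥0∞} (hε : ε ≠ 0) :
    ∀ᶠ N in atTop, ∃ μ ∈ Atomic N Ω, wassersteinDist p μ ρ ^ p ≤ ε + ε + ε ∧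
      discreteEnergy H N μ ≤ energy H Ω ρ + ε + ε := by
  have hρ_prob : IsProbabilityMeasure ρ := hρ.1
  obtain ⟨x₀, hx₀, x₁, hx₁, hx⟩ := hΩ'.exists_lt
  obtain ⟨c, L, K, hL, hK, hcΩ, hx₀c, h_out, h_mesh, h_tail, h_energy⟩ :=
    exists_grid hp hH hΩ hρ hx₀ hx₁ hx hε
  have h_moment := lintegral_edist_add_rpow_ne_top hp.le hρ.2.2.ne x₀
    (C := 2 * ENNReal.ofReal L) (by finiteness)
  filter_upwards [eventually_exists_atomic_grid hp hH hL hcΩ hx₀c hK h_moment h_out hε]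
    with N ⟨μ, hμ, hW, hE⟩
  exact ⟨μ, hμ, hW.trans (by gcongr), hE.trans (by gcongr)⟩

theorem nonempty_atomic {Ω : Set ℝ} (hΩ : Ω.Infinite) (N : ℕ) : (Atomic N Ω).Nonempty := by
  obtain ⟨S, hSΩ, hS⟩ := hΩ.exists_subset_card_eq N
  exact ⟨_, S.orderEmbOfFin hS, (S.orderEmbOfFin hS).strictMono,
    fun i => hSΩ (S.orderEmbOfFin_mem hS i), rfl⟩

theorem exists_tendsto_zero_of_eventually_exists_le {α : Type*} {A : ℕ → Set α} (f : ℕ → α → ℝ≥0∞)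
    (hA : ∀ N, (A N).Nonempty) (hf : ∀ ε, ε ≠ 0 → ∀ᶠ N in atTop, ∃ x ∈ A N, f N x ≤ ε) :
    ∃ x : ℕ → α, (∀ N, x N ∈ A N) ∧ Tendsto (fun N => f N (x N)) atTop (𝓝 0) := by
  have h_near : ∀ N, ∃ x ∈ A N, f N x ≤ (⨅ y ∈ A N, f N y) + (N : ℝ≥0∞)⁻¹ := fun N => by
    rcases eq_or_ne (⨅ y ∈ A N, f N y) ∞ with h_top | h_top
    · obtain ⟨x, hx⟩ := hA N
      exact ⟨x, hx, by simp [h_top]⟩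
    · have h_lt := ENNReal.lt_add_right h_top (ENNReal.inv_ne_zero.2 (ENNReal.natCast_ne_top N))
      obtain ⟨x, hx, hfx⟩ := by simpa only [iInf_lt_iff, exists_prop] using h_lt
      exact ⟨x, hx, hfx.le⟩
  choose x hx hfx using h_near
  have h_inf : Tendsto (fun N => ⨅ y ∈ A N, f N y) atTop (𝓝 0) :=
    ENNReal.tendsto_nhds_zero.2 fun ε hε => by
      filter_upwards [hf ε hε.ne'] with N ⟨y, hy, hfy⟩
      exact (iInf₂_le y hy).trans hfy
  refine ⟨x, hx, tendsto_of_tendsto_of_tendsto_of_le_of_le tendsto_const_nhds ?_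
    (fun _ => zero_le) hfx⟩
  simpa using h_inf.add ENNReal.tendsto_inv_nat_nhds_zero

theorem exists_recovery_sequence {p : ℝ} (hp : 0 < p) {H : ℝ → ℝ} (hH : IsConvexDensity H)
    {Ω : Set ℝ} (hΩ : Ω.OrdConnected) (hΩ' : Ω.Nontrivial) {ρ : Measure ℝ} (hρ : ρ ∈ ProbP p Ω) :
    ∃ μ : ℕ → Measure ℝ, (∀ N, μ N ∈ Atomic N Ω) ∧
      Tendsto (fun N => wassersteinDist p (μ N) ρ) atTop (𝓝 0) ∧
      limsup (fun N => discreteEnergy H N (μ N)) atTop ≤ energy H Ω ρ := by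
  let f : ℕ → Measure ℝ → ℝ≥0∞ := fun N μ =>
    wassersteinDist p μ ρ ^ p + (discreteEnergy H N μ - energy H Ω ρ)
  have hΩ_inf : Ω.Infinite := by
    obtain ⟨x, hx, y, hy, hxy⟩ := hΩ'.exists_lt
    exact (Icc_infinite hxy).mono (hΩ.out hx hy)
  obtain ⟨μ, hμ, hf⟩ : ∃ μ : ℕ → Measure ℝ, (∀ N, μ N ∈ Atomic N Ω) ∧
      Tendsto (fun N => f N (μ N)) atTop (𝓝 0) := by
    refine exists_tendsto_zero_of_eventually_exists_le f (nonempty_atomic hΩ_inf) fun ε hε => ?_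
    have h_fifth : 5 * (ε / 5) = ε := ENNReal.mul_div_cancel (by simp) (by simp)
    filter_upwards [eventually_exists_atomic_near hp hH hΩ hΩ' hρ
      (ENNReal.div_ne_zero.2 ⟨hε, by simp⟩ : ε / 5 ≠ 0)] with N ⟨μ, hμ, hW, hE⟩
    have h_excess : discreteEnergy H N μ - energy H Ω ρ ≤ ε / 5 + ε / 5 :=
      tsub_le_iff_left.2 (hE.trans_eq (add_assoc _ _ _))
    exact ⟨μ, hμ, (add_le_add hW h_excess).trans_eq (Eq.trans (by ring) h_fifth)⟩
  refine ⟨μ, hμ, ?_, ?_⟩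
  · have h_rpow : Tendsto (fun N => wassersteinDist p (μ N) ρ ^ p) atTop (𝓝 0) :=
      tendsto_of_tendsto_of_tendsto_of_le_of_le tendsto_const_nhds hf (fun _ => zero_le)
        fun _ => le_self_add
    simpa [hp, hp.ne'] using h_rpow.ennrpow_const p⁻¹
  · calc limsup (fun N => discreteEnergy H N (μ N)) atTop
        ≤ limsup (fun N => energy H Ω ρ + f N (μ N)) atTop :=
          limsup_le_limsup (.of_forall fun _ => le_add_tsub.trans (add_le_add_right le_add_self _))
      _ = energy H Ω ρ := by simpa using (hf.const_add (energy H Ω ρ)).limsup_eq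

theorem IsAdmissibleDomain.ordConnected {Ω : Set ℝ} (hΩ : IsAdmissibleDomain Ω) :
    Ω.OrdConnected := by
  rcases hΩ with rfl | ⟨a, b, -, rfl⟩
  exacts [ordConnected_univ, ordConnected_Icc]

theorem IsAdmissibleDomain.nontrivial {Ω : Set ℝ} (hΩ : IsAdmissibleDomain Ω) :
    Ω.Nontrivial := by
  rcases hΩ with rfl | ⟨a, b, hab, rfl⟩
  exacts [nontrivial_univ, ⟨a, left_mem_Icc.2 hab.le, b, right_mem_Icc.2 hab.le, hab.ne⟩]

end ParticleGamma

theorem theorem4p2_general {p : ℝ} (hp : 0 < p) {Ω : Set ℝ} (hΩ : Ω.OrdConnected)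
    (hΩ' : Ω.Nontrivial) {H : ℝ → ℝ} (hH : ParticleGamma.IsConvexDensity H)
    (hsl : Tendsto (fun x => H x / x) atTop atTop) :
    ParticleGamma.GammaConverges p Ω (fun N => ParticleGamma.discreteEnergy H N)
      (ParticleGamma.energy H Ω) := by
  intro ρ hρ
  have : IsProbabilityMeasure ρ := hρ.1
  obtain ⟨μ, hμ, hW, hE⟩ := ParticleGamma.exists_recovery_sequence hp hH hΩ hΩ' hρ
  refine ⟨fun ν hν hνW => ?_, μ, fun N _ => hμ N, hW, hE⟩
  exact (ParticleGamma.energy_le_intervalEnergy hH hsl Ω ρ).trans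
    (ParticleGamma.intervalEnergy_le_liminf_discreteEnergy hH hp hν hνW)

theorem theorem4p2 (p : ℝ) (hp : 1 < p) (Ω : Set ℝ) (hΩ : ParticleGamma.IsAdmissibleDomain Ω)
    (H : ℝ → ℝ) (hH : ParticleGamma.IsEnergyDensity H)
    (hscal : ParticleGamma.ScalingCondition H) :
    ParticleGamma.GammaConverges p Ω (fun N => ParticleGamma.discreteEnergy H N)
      (ParticleGamma.energy H Ω) :=
  theorem4p2_general (zero_lt_one.trans hp) hΩ.ordConnected hΩ.nontrivial hH.isConvexDensity
    hH.superlinear
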